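/- Let $k$ be an algebraically closed field of characteristic zero, $\mathfrak g$ a finite-dimensional reductive Lie algebra over $k$, $S$ a finitely generated commutative unital $k$-algebra, and $\Gamma$ a finite group acting on $S$ by $k$-algebra automorphisms. Let $u:\Gamma\to\mathrm{Aut}_{S\text{-Lie}}(\mathfrak g\otimes_k S)$ be a crossed homomorphism, let $\Gamma$ act on $\mathfrak g\otimes_k S$ by ${}^\gamma(x\otimes s)=u_\gamma(x\otimes{}^\gamma s)$, and let $\mathcal L=(\mathfrak g\otimes_k S)^\Gamma$ be the associated twisted current algebra, with derived subalgebra $\mathcal L'=[\mathcal L,\mathcal L]$. For a maximal ideal $M$ of $S$ let $\mathrm{ev}_M:\mathfrak g\otimes_k S\to\mathfrak g$, $x\otimes s\mapsto s(M)x$, where $s(M)\in k\cong S/M$ is the class of $s$. For $\gamma\in\Gamma$ let $\gamma(M)$ be the automorphism $x\mapsto\mathrm{ev}_M({}^\gamma(x\otimes 1))$ of $\mathfrak g$, and let $\mathfrak g^M=\{x\in\mathfrak g : \gamma(M)x=x \text{ for all } \gamma\in\Gamma \text{ with } {}^\gamma M=M\}$, so that $\mathrm{ev}_M(\mathcal L)\subseteq\mathfrak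 g^M$. Every $\mathfrak g^M$-module is regarded as an $\mathcal L$-module through $\mathrm{ev}_M$. Let $\mathrm{Rep}(\mathfrak g^M)$ be the set of isomorphism classes of finite-dimensional simple $\mathfrak g^M$-modules and $k_0$ the trivial one-dimensional module. A finite-dimensional $\mathcal L$-module is an evaluation module if it is annihilated by $\mathcal L\cap\bigcap_{M\in T}\ker\mathrm{ev}_M$ for some finite set $T$ of maximal ideals of $S$. If $E\cong\bigotimes_i E_i$ is a simple evaluation module, with simple finite-dimensional $\mathfrak g^{M_i}$-modules $(E_i,\rho_i)$ for maximal ideals $M_i$ in distinct $\Gamma$-orbits, its section is the map $f_E$ on $\mathrm{Max}\,S$ with $f_E(N)=[(E_i,\rho_i\circ\gamma(N)^{-1})]\in\mathrm{Rep}(\mathfrak g^N)$ if $N={}^\gamma M_i$ for some $\gamma\in\Gamma$ and some $i$, and $f_E(N)=[k_0]$ otherwise. The support of $E$ is $\mathrm{supp}\,E=\{N\in\mathrm{Max}\,S : f_E(N)\neq[k_0]\}$. For $\mathcal L$-modules $V,W$, $\mathrm{Ext}^1_{\mathcal L}(V,W)$ is the $k$-vector space of equivalence classes of extensions $0\to W\to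 X\to V\to0$ of $\mathcal L$-modules. **Theorem.** Let $E$ and $F$ be finite-dimensional simple evaluation modules of $\mathcal L$, with sections $f_E$ and $f_F$. Let $\{M_i\}_{i=1}^r\subseteq\mathrm{Max}\,S$ be a set of representatives of the $\Gamma$-orbits in $\mathrm{supp}\,E\cup\mathrm{supp}\,F$, and write $E\cong\bigotimes_{i=1}^rE_i$ and $F\cong\bigotimes_{i=1}^rF_i$, where $E_i$ and $F_i$ are finite-dimensional simple $\mathfrak g^{M_i}$-modules. Then: 1. If $f_E$ and $f_F$ differ on more than one $\Gamma$-orbit of $\mathrm{Max}\,S$, then $\mathrm{Ext}^1_{\mathcal L}(E,F)=0$. 2. If $f_E$ and $f_F$ differ exactly on the single $\Gamma$-orbit of $M_j$, then $\mathrm{Ext}^1_{\mathcal L}(E,F)\cong\mathrm{Ext}^1_{\mathcal L}(E_j,F_j)$ as $k$-vector spaces. 3. If $f_E=f_F$ and $r\ge1$, then, as $k$-vector spaces, $$\big((\mathcal L/\mathcal L')^*\big)^{\oplus(r-1)}\oplus\mathrm{Ext}^1_{\mathcal L}(E,F)\;\cong\;\bigoplus_{i=1}^r\mathrm{Ext}^1_{\mathcal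 L}(E_i,F_i).$$ -/

import Mathlib

open scoped TensorProduct

noncomputable section

namespace TwistedCurrent

universe v

/-! ### First cohomology and extensions of Lie algebra modules -/

section Ext

variable (k L : Type*) [Field k] [LieRing L] [LieAlgebra k L]

/-- `H¹(L, V) = Der(L, V) / IDer(L, V)`. -/
abbrev H1 (V : Type*) [AddCommGroup V] [Module k V] [LieRingModule L V] [LieModule k L V] :
    Type _ :=
  LieDerivation k L V ⧸ LinearMap.range (LieDerivation.inner k L V)

/-- Extensions `0 → W → X → V → 0` of the `L`-module `V` by the `L`-module `W`. -/
structure ModExtension (V W : Type v)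
    [AddCommGroup V] [Module k V] [LieRingModule L V] [LieModule k L V]
    [AddCommGroup W] [Module k W] [LieRingModule L W] [LieModule k L W] where
  X : Type v
  [addCommGroup : AddCommGroup X]
  [module : Module k X]
  [lieRingModule : LieRingModule L X]
  [lieModule : LieModule k L X]
  incl : W →ₗ⁅k, L⁆ X
  proj : X →ₗ⁅k, L⁆ V
  injective : Function.Injective incl
  surjective : Function.Surjective proj
  exact : Function.Exact incl proj

attribute [instance] ModExtension.addCommGroup ModExtension.module
  ModExtension.lieRingModule ModExtension.lieModule

variable (V W : Type v)
  [AddCommGroup V] [Module k V] [LieRingModule L V] [LieModule k L V]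
  [AddCommGroup W] [Module k W] [LieRingModule L W] [LieModule k L W]

/-- Two extensions are equivalent if there is an `L`-module isomorphism between the middle terms
which is compatible with the inclusions of `W` and the projections to `V`. -/
instance ModExtension.setoid : Setoid (ModExtension k L V W) where
  r A B := ∃ φ : A.X ≃ₗ⁅k, L⁆ B.X, (∀ w, φ (A.incl w) = B.incl w) ∧ ∀ x, B.proj (φ x) = A.proj x
  iseqv :=
    { refl := fun A => ⟨LieModuleEquiv.refl, fun _ => rfl, fun _ => rfl⟩
      symm := by
        rintro A B ⟨φ, h₁, h₂⟩
        refine ⟨φ.symm, fun w => ?_, fun x => ?_⟩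
        · rw [← h₁ w, LieModuleEquiv.symm_apply_apply]
        · rw [← h₂ (φ.symm x), LieModuleEquiv.apply_symm_apply]
      trans := by
        rintro A B C ⟨φ, h₁, h₂⟩ ⟨ψ, h₃, h₄⟩
        refine ⟨φ.trans ψ, fun w => ?_, fun x => ?_⟩
        · rw [LieModuleEquiv.trans_apply, h₁, h₃]
        · rw [LieModuleEquiv.trans_apply, h₄, h₂] }

/-- `Ext¹_L(V, W)`: the set of equivalence classes of extensions of `V` by `W`. -/
def Ext1 : Type _ := Quotient (ModExtension.setoid k L V W)

variable {k L V W}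

/-- The underlying space `W × V` of the extension attached to a derivation `L → Hom(V, W)`. -/
@[nolint unusedArguments]
def CocycleModule (_ : LieDerivation k L (V →ₗ[k] W)) : Type v := W × V

/-- The element `(w, y)` of `W × V`. -/
def CocycleModule.mk (c : LieDerivation k L (V →ₗ[k] W)) (w : W) (y : V) : CocycleModule c := (w, y)

instance (c : LieDerivation k L (V →ₗ[k] W)) : AddCommGroup (CocycleModule c) :=
  inferInstanceAs (AddCommGroup (W × V))

instance (c : LieDerivation k L (V →ₗ[k] W)) : Module k (CocycleModule c) :=
  inferInstanceAs (Module k (W × V))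

instance (c : LieDerivation k L (V →ₗ[k] W)) : LieRingModule L (CocycleModule c) where
  bracket x p := ((⁅x, p.1⁆ + c x p.2, ⁅x, p.2⁆) : W × V)
  add_lie x y p := by
    refine Prod.ext ?_ ?_
    · change ⁅x + y, p.1⁆ + c (x + y) p.2 = (⁅x, p.1⁆ + c x p.2) + (⁅y, p.1⁆ + c y p.2)
      rw [add_lie, map_add, LinearMap.add_apply]; abel
    · exact add_lie x y p.2
  lie_add x p q := by
    refine Prod.ext ?_ ?_
    · change ⁅x, p.1 + q.1⁆ + c x (p.2 + q.2) = (⁅x, p.1⁆ + c x p.2) + (⁅x, q.1⁆ + c x q.2)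
      rw [lie_add, map_add]; abel
    · exact lie_add x p.2 q.2
  leibniz_lie x y p := by
    refine Prod.ext ?_ ?_
    · change ⁅x, ⁅y, p.1⁆ + c y p.2⁆ + c x ⁅y, p.2⁆ =
        (⁅⁅x, y⁆, p.1⁆ + c ⁅x, y⁆ p.2) + (⁅y, ⁅x, p.1⁆ + c x p.2⁆ + c y ⁅x, p.2⁆)
      rw [LieDerivation.apply_lie_eq_sub, lie_add, lie_add, leibniz_lie x y p.1,
        LinearMap.sub_apply, LieHom.lie_apply, LieHom.lie_apply]
      abel
    · exact leibniz_lie x y p.2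

instance (c : LieDerivation k L (V →ₗ[k] W)) : LieModule k L (CocycleModule c) where
  smul_lie t x p := by
    refine Prod.ext ?_ ?_
    · change ⁅t • x, p.1⁆ + c (t • x) p.2 = t • (⁅x, p.1⁆ + c x p.2)
      rw [smul_lie, map_smul, LinearMap.smul_apply, smul_add]
    · exact smul_lie t x p.2
  lie_smul t x p := by
    refine Prod.ext ?_ ?_
    · change ⁅x, t • p.1⁆ + c x (t • p.2) = t • (⁅x, p.1⁆ + c x p.2)
      rw [lie_smul, map_smul, smul_add]
    · exact lie_smul t x p.2

/-- The extension attached to a derivation `L → Hom(V, W)`. -/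
def cocycleExtension (c : LieDerivation k L (V →ₗ[k] W)) : ModExtension k L V W where
  X := CocycleModule c
  incl :=
    { toFun := fun w => ((w, 0) : W × V)
      map_add' := fun w w' => by
        refine Prod.ext rfl ?_
        exact (add_zero (0 : V)).symm
      map_smul' := fun t w => by
        refine Prod.ext rfl ?_
        exact (smul_zero t).symm
      map_lie' := fun {x w} => by
        refine Prod.ext ?_ ?_
        · change ⁅x, w⁆ = ⁅x, w⁆ + c x 0
          rw [map_zero, add_zero]
        · exact (lie_zero x).symm }
  proj :=
    { toFun := fun p => p.2
      map_add' := fun _ _ => rfl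
      map_smul' := fun _ _ => rfl
      map_lie' := fun {_ _} => rfl }
  injective := fun w w' h => congrArg Prod.fst h
  surjective := fun y => ⟨((0, y) : W × V), rfl⟩
  exact := by
    intro p
    constructor
    · intro h
      exact ⟨p.1, Prod.ext rfl (Eq.symm h)⟩
    · rintro ⟨w, rfl⟩
      rfl

theorem cocycleExtension_equiv_iff (c d : LieDerivation k L (V →ₗ[k] W)) :
    cocycleExtension c ≈ cocycleExtension d ↔
      c - d ∈ LinearMap.range (LieDerivation.inner k L (V →ₗ[k] W)) := by
  constructor
  · rintro ⟨φ₀, h₁, h₂⟩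
    let φ : CocycleModule c ≃ₗ⁅k, L⁆ CocycleModule d := φ₀
    have h₁' : ∀ w : W, φ (.mk c w 0) = .mk d w 0 := h₁
    let f : V → W := fun y => (φ (.mk c 0 y)).1
    have hφ : ∀ y : V, φ (.mk c 0 y) = .mk d (f y) y :=
      fun y => Prod.ext rfl (h₂ (CocycleModule.mk c 0 y))
    have hsplit : ∀ (w : W) (y : V), φ (.mk c w y) = .mk d (w + f y) y := by
      intro w y
      have e : CocycleModule.mk c w y = .mk c w 0 + .mk c 0 y :=
        Prod.ext (add_zero w).symm (zero_add y).symm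
      rw [e, map_add, hφ y, h₁']
      exact Prod.ext rfl (zero_add y)
    have hadd : ∀ y z, f (y + z) = f y + f z := by
      intro y z
      have e : CocycleModule.mk c 0 (y + z) = .mk c 0 y + .mk c 0 z :=
        Prod.ext (add_zero 0).symm rfl
      have := map_add φ (.mk c 0 y) (.mk c 0 z)
      rw [← e, hφ, hφ, hφ] at this
      exact congrArg Prod.fst this
    have hsmul : ∀ (t : k) y, f (t • y) = t • f y := by
      intro t y
      have e : CocycleModule.mk c 0 (t • y) = t • .mk c 0 y :=
        Prod.ext (smul_zero t).symm rfl
      have := map_smul φ t (.mk c 0 y)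
      rw [← e, hφ, hφ] at this
      exact congrArg Prod.fst this
    refine ⟨⟨⟨f, hadd⟩, hsmul⟩, ?_⟩
    ext x y
    have := LieModuleHom.map_lie (φ : CocycleModule c →ₗ⁅k, L⁆ CocycleModule d) x (.mk c 0 y)
    change φ _ = ⁅x, φ _⁆ at this
    rw [hφ] at this
    have e : ⁅x, CocycleModule.mk c 0 y⁆ = .mk c (c x y) ⁅x, y⁆ := by
      refine Prod.ext ?_ rfl
      change ⁅x, (0 : W)⁆ + c x y = c x y
      rw [lie_zero, zero_add]
    rw [e, hsplit] at this
    have h3 : c x y + f ⁅x, y⁆ = ⁅x, f y⁆ + d x y := congrArg Prod.fst this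
    change ⁅x, f y⁆ - f ⁅x, y⁆ = c x y - d x y
    rw [sub_eq_sub_iff_add_eq_add, ← h3]
  · rintro ⟨f, hf⟩
    have key : ∀ x y, ⁅x, f y⁆ - f ⁅x, y⁆ = c x y - d x y := by
      intro x y
      exact congrArg (fun D : LieDerivation k L (V →ₗ[k] W) => D x y) hf
    refine ⟨{ toFun := fun p => ((p.1 + f p.2, p.2) : W × V)
              invFun := fun p => ((p.1 - f p.2, p.2) : W × V)
              map_add' := fun p q => ?_
              map_smul' := fun t p => ?_
              map_lie' := fun {x p} => ?_
              left_inv := fun p => ?_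
              right_inv := fun p => ?_ }, fun w => ?_, fun x => rfl⟩
    · refine Prod.ext ?_ rfl
      change (p.1 + q.1) + f (p.2 + q.2) = (p.1 + f p.2) + (q.1 + f q.2)
      rw [map_add]; abel
    · refine Prod.ext ?_ rfl
      change t • p.1 + f (t • p.2) = t • (p.1 + f p.2)
      rw [map_smul, smul_add]
    · refine Prod.ext ?_ rfl
      change (⁅x, p.1⁆ + c x p.2) + f ⁅x, p.2⁆ = ⁅x, p.1 + f p.2⁆ + d x p.2
      have := key x p.2
      rw [sub_eq_sub_iff_add_eq_add] at this
      rw [lie_add, add_assoc, add_assoc, this]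
    · exact Prod.ext (add_sub_cancel_right _ _) rfl
    · exact Prod.ext (sub_add_cancel _ _) rfl
    · refine Prod.ext ?_ rfl
      change w + f 0 = w
      rw [map_zero, add_zero]

theorem exists_cocycleExtension (A : ModExtension k L V W) :
    ∃ c : LieDerivation k L (V →ₗ[k] W), cocycleExtension c ≈ A := by
  obtain ⟨s, hs⟩ := (A.proj : A.X →ₗ[k] V).exists_rightInverse_of_surjective
    (LinearMap.range_eq_top.mpr A.surjective)
  obtain ⟨ρ, hρ⟩ := (A.incl : W →ₗ[k] A.X).exists_leftInverse_of_injective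
    (LinearMap.ker_eq_bot.mpr A.injective)
  have hs' : ∀ y, A.proj (s y) = y := fun y => LinearMap.congr_fun hs y
  have hρ' : ∀ w, ρ (A.incl w) = w := fun w => LinearMap.congr_fun hρ w
  have hker : ∀ a : A.X, A.proj a = 0 → A.incl (ρ a) = a := by
    intro a ha
    obtain ⟨w, rfl⟩ := (A.exact a).mp ha
    rw [hρ']
  have hk : ∀ (x : L) (y : V), A.incl (ρ (⁅x, s y⁆ - s ⁅x, y⁆)) = ⁅x, s y⁆ - s ⁅x, y⁆ := by
    intro x y
    apply hker
    rw [map_sub, LieModuleHom.map_lie, hs', hs', sub_self]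
  let c₀ : L →ₗ[k] (V →ₗ[k] W) := LinearMap.mk₂ k (fun x y => ρ (⁅x, s y⁆ - s ⁅x, y⁆))
    (by intro x x' y; rw [← map_add]; congr 1; rw [add_lie, add_lie, map_add]; abel)
    (by intro t x y; rw [← map_smul]; congr 1; rw [smul_lie, smul_lie, map_smul, smul_sub])
    (by intro x y y'; rw [← map_add]; congr 1; rw [map_add, lie_add, lie_add, map_add]; abel)
    (by intro t x y; rw [← map_smul]; congr 1
        rw [map_smul, lie_smul, lie_smul, map_smul, smul_sub])
  have hc₀ : ∀ x y, A.incl (c₀ x y) = ⁅x, s y⁆ - s ⁅x, y⁆ := hk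
  let c : LieDerivation k L (V →ₗ[k] W) :=
    { toLinearMap := c₀
      leibniz' := by
        intro x y
        ext z
        apply A.injective
        rw [LinearMap.sub_apply, LieHom.lie_apply, LieHom.lie_apply, map_sub, map_sub, map_sub,
          LieModuleHom.map_lie, LieModuleHom.map_lie]
        simp only [hc₀]
        rw [lie_sub, lie_sub, lie_lie, lie_lie, map_sub]
        abel }
  refine ⟨c, ?_⟩
  refine ⟨{ toFun := fun p => A.incl p.1 + s p.2
            invFun := fun a => ((ρ (a - s (A.proj a)), A.proj a) : W × V)
            map_add' := fun p q => ?_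
            map_smul' := fun t p => ?_
            map_lie' := fun {x p} => ?_
            left_inv := fun p => ?_
            right_inv := fun a => ?_ }, fun w => ?_, fun p => ?_⟩
  · change A.incl (p.1 + q.1) + s (p.2 + q.2) = (A.incl p.1 + s p.2) + (A.incl q.1 + s q.2)
    rw [map_add, map_add]; abel
  · change A.incl (t • p.1) + s (t • p.2) = t • (A.incl p.1 + s p.2)
    rw [map_smul, map_smul, smul_add]
  · change A.incl (⁅x, (p.1 : W)⁆ + c₀ x p.2) + s ⁅x, (p.2 : V)⁆ = ⁅x, A.incl p.1 + s p.2⁆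
    rw [map_add, hc₀, LieModuleHom.map_lie, lie_add]; abel
  · have e : A.proj (A.incl p.1 + s p.2) = p.2 := by
      rw [map_add, hs', (A.exact _).mpr ⟨p.1, rfl⟩, zero_add]
    refine Prod.ext ?_ e
    change ρ (A.incl p.1 + s p.2 - s (A.proj (A.incl p.1 + s p.2))) = p.1
    rw [e, add_sub_cancel_right, hρ']
  · change A.incl (ρ (a - s (A.proj a))) + s (A.proj a) = a
    rw [hker _ (by rw [map_sub, hs', sub_self]), sub_add_cancel]
  · change A.incl w + s 0 = A.incl w
    rw [map_zero, add_zero]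
  · change A.proj (A.incl p.1 + s p.2) = p.2
    rw [map_add, hs', (A.exact _).mpr ⟨p.1, rfl⟩, zero_add]

variable (k L V W)

/-- The map sending the class of a derivation to the class of the corresponding extension. -/
def H1.toExt1 : H1 k L (V →ₗ[k] W) → Ext1 k L V W :=
  Quotient.lift (fun c => (Quotient.mk _ (cocycleExtension c) : Ext1 k L V W)) (by
    intro c d h
    apply Quotient.sound
    rw [cocycleExtension_equiv_iff]
    exact (Submodule.quotientRel_def _).mp h)

theorem H1.toExt1_bijective : Function.Bijective (H1.toExt1 k L V W) := by
  constructor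
  · intro a b
    induction a using Submodule.Quotient.induction_on with
    | _ c =>
      induction b using Submodule.Quotient.induction_on with
      | _ d =>
        intro h
        have h' : cocycleExtension c ≈ cocycleExtension d := Quotient.exact h
        rw [cocycleExtension_equiv_iff] at h'
        exact (Submodule.Quotient.eq _).mpr h'
  · intro a
    induction a using Quotient.inductionOn with
    | _ A =>
      obtain ⟨c, hc⟩ := exists_cocycleExtension A
      exact ⟨Submodule.Quotient.mk c, Quotient.sound hc⟩

/-- The natural bijection between `Ext¹_L(V, W)` and `H¹(L, Hom_k(V, W))`. -/
def Ext1.equivH1 : Ext1 k L V W ≃ H1 k L (V →ₗ[k] W) :=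
  (Equiv.ofBijective _ (H1.toExt1_bijective k L V W)).symm

/-- `Ext¹_L(V, W)` is a vector space through its natural bijection with `H¹(L, Hom_k(V, W))`;
the sum is the Baer sum. -/
instance : AddCommGroup (Ext1 k L V W) := (Ext1.equivH1 k L V W).addCommGroup

instance : Module k (Ext1 k L V W) := (Ext1.equivH1 k L V W).module k

end Ext

/-! ### Pullbacks and tensor products of modules -/

section Modules

variable {k L G : Type*} [Field k] [LieRing L] [LieAlgebra k L] [LieRing G] [LieAlgebra k G]

/-- The pullback of a `G`-module `V` along a homomorphism of Lie algebras `f : L → G`. -/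
@[nolint unusedArguments]
def Pullback (_ : L →ₗ⁅k⁆ G) (V : Type*) : Type _ := V

section

variable (f : L →ₗ⁅k⁆ G) (V : Type*) [AddCommGroup V] [Module k V]

instance : AddCommGroup (Pullback f V) := inferInstanceAs (AddCommGroup V)

instance : Module k (Pullback f V) := inferInstanceAs (Module k V)

instance [FiniteDimensional k V] : FiniteDimensional k (Pullback f V) :=
  inferInstanceAs (FiniteDimensional k V)

variable [LieRingModule G V]

instance : LieRingModule L (Pullback f V) := LieRingModule.compLieHom V f

instance [LieModule k G V] : LieModule k L (Pullback f V) := LieModule.compLieHom V f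

theorem Pullback.isIrreducible [LieModule k G V] (hf : Function.Surjective f)
    [h : LieModule.IsIrreducible k G V] : LieModule.IsIrreducible k L (Pullback f V) := by
  have : Nontrivial V := (LieSubmodule.nontrivial_iff k G V).mp inferInstance
  have : Nontrivial (Pullback f V) := this
  apply LieModule.IsIrreducible.mk
  intro N hN
  let N' : LieSubmodule k G V :=
    { (N : Submodule k (Pullback f V)) with
      lie_mem := by
        intro x m hm
        obtain ⟨y, rfl⟩ := hf x
        exact N.lie_mem (x := y) hm }
  have hmem : ∀ m : V, m ∈ N' ↔ (show Pullback f V from m) ∈ N := fun m => Iff.rfl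
  rcases eq_bot_or_eq_top N' with h0 | h1
  · exfalso
    apply hN
    rw [LieSubmodule.eq_bot_iff] at h0 ⊢
    exact h0
  · rw [eq_top_iff]
    intro m _
    exact (hmem m).mp (h1 ▸ LieSubmodule.mem_top (R := k) (L := G) (show V from m))

end

section Tensor

variable {ι : Type*} [Fintype ι] [DecidableEq ι] (V : ι → Type*)
  [∀ i, AddCommGroup (V i)] [∀ i, Module k (V i)]
  [∀ i, LieRingModule L (V i)] [∀ i, LieModule k L (V i)]

/-- `x` acts on `⨂ V i` by `∑ i, 1 ⊗ ⋯ ⊗ x ⊗ ⋯ ⊗ 1` (with `x` in position `i`). -/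
def tensorAction (x : L) : Module.End k (⨂[k] i, V i) :=
  ∑ i, PiTensorProduct.map
    (Function.update (fun _ => LinearMap.id) i (LieModule.toEnd k L (V i) x))

theorem tensorAction_tprod (x : L) (w : ∀ i, V i) :
    tensorAction V x (PiTensorProduct.tprod k w) =
      ∑ i, PiTensorProduct.tprod k (Function.update w i ⁅x, w i⁆) := by
  rw [tensorAction, LinearMap.sum_apply]
  refine Finset.sum_congr rfl fun i _ => ?_
  rw [PiTensorProduct.map_tprod]
  congr 1
  funext j
  by_cases hj : j = i
  · subst hj; simp
  · simp [Function.update_of_ne hj]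

theorem tensorAction_add (x y : L) :
    tensorAction (k := k) V (x + y) = tensorAction V x + tensorAction V y := by
  simp only [tensorAction, map_add, PiTensorProduct.map_update_add, Finset.sum_add_distrib]

theorem tensorAction_smul (t : k) (x : L) :
    tensorAction (k := k) V (t • x) = t • tensorAction V x := by
  simp only [tensorAction, map_smul, PiTensorProduct.map_update_smul, Finset.smul_sum]

theorem tensorAction_lie (x y : L) :
    tensorAction (k := k) V ⁅x, y⁆ =
      tensorAction V x * tensorAction V y - tensorAction V y * tensorAction V x := by
  apply PiTensorProduct.ext
  ext w
  have key : ∀ a b : L, tensorAction (k := k) V a (tensorAction V b (PiTensorProduct.tprod k w)) =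
      ∑ i, (PiTensorProduct.tprod k (Function.update w i ⁅a, ⁅b, w i⁆⁆) +
        ∑ j ∈ Finset.univ.erase i, PiTensorProduct.tprod k
          (Function.update (Function.update w i ⁅b, w i⁆) j ⁅a, w j⁆)) := by
    intro a b
    rw [tensorAction_tprod, map_sum]
    refine Finset.sum_congr rfl fun i _ => ?_
    rw [tensorAction_tprod, ← Finset.add_sum_erase _ _ (Finset.mem_univ i)]
    congr 1
    · simp
    · refine Finset.sum_congr rfl fun j hj => ?_
      rw [Function.update_of_ne (Finset.ne_of_mem_erase hj)]
  have hsymm : ∑ i, ∑ j ∈ Finset.univ.erase i, PiTensorProduct.tprod k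
        (Function.update (Function.update w i ⁅y, w i⁆) j ⁅x, w j⁆) =
      ∑ i, ∑ j ∈ Finset.univ.erase i, PiTensorProduct.tprod k
        (Function.update (Function.update w i ⁅x, w i⁆) j ⁅y, w j⁆) := by
    rw [Finset.sum_comm' (t' := Finset.univ) (s' := fun j => Finset.univ.erase j)
      (by intro a b; simp [eq_comm])]
    refine Finset.sum_congr rfl fun i _ => Finset.sum_congr rfl fun j hj => ?_
    rw [Function.update_comm (Finset.ne_of_mem_erase hj)]
  simp only [LinearMap.compMultilinearMap_apply, LinearMap.sub_apply, Module.End.mul_apply]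
  rw [key, key, Finset.sum_add_distrib, Finset.sum_add_distrib, hsymm, add_sub_add_right_eq_sub,
    tensorAction_tprod, ← Finset.sum_sub_distrib]
  refine Finset.sum_congr rfl fun i _ => ?_
  rw [lie_lie, MultilinearMap.map_update_sub]

/-- The tensor product of a finite family of `L`-modules is an `L`-module. -/
instance : LieRingModule L (⨂[k] i, V i) where
  bracket x m := tensorAction V x m
  add_lie x y m := by
    change tensorAction V (x + y) m = tensorAction V x m + tensorAction V y m
    rw [tensorAction_add, LinearMap.add_apply]
  lie_add x m n := map_add (tensorAction V x) m n
  leibniz_lie x y m := by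
    change tensorAction V x (tensorAction V y m) =
      tensorAction V ⁅x, y⁆ m + tensorAction V y (tensorAction V x m)
    rw [tensorAction_lie, LinearMap.sub_apply, Module.End.mul_apply, Module.End.mul_apply,
      sub_add_cancel]

instance : LieModule k L (⨂[k] i, V i) where
  smul_lie t x m := by
    change tensorAction V (t • x) m = t • tensorAction V x m
    rw [tensorAction_smul, LinearMap.smul_apply]
  lie_smul t x m := map_smul (tensorAction V x) t m

end Tensor

section Classes

variable (k G)

/-- A finite-dimensional simple `G`-module. -/
structure SimpleModule where
  V : Type v
  [addCommGroup : AddCommGroup V]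
  [module : Module k V]
  [lieRingModule : LieRingModule G V]
  [lieModule : LieModule k G V]
  [finite : FiniteDimensional k V]
  [irreducible : LieModule.IsIrreducible k G V]

attribute [instance] SimpleModule.addCommGroup SimpleModule.module
  SimpleModule.lieRingModule SimpleModule.lieModule SimpleModule.finite SimpleModule.irreducible

instance SimpleModule.setoid : Setoid (SimpleModule.{v} k G) where
  r A B := Nonempty (A.V ≃ₗ⁅k, G⁆ B.V)
  iseqv :=
    { refl := fun _ => ⟨LieModuleEquiv.refl⟩
      symm := fun ⟨e⟩ => ⟨e.symm⟩
      trans := fun ⟨e⟩ ⟨f⟩ => ⟨e.trans f⟩ }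

/-- `Rep(G)`: the isomorphism classes of finite-dimensional simple `G`-modules. -/
def Rep : Type _ := Quotient (SimpleModule.setoid.{v} k G)

/-- The isomorphism class of a finite-dimensional simple `G`-module. -/
def Rep.mk (V : Type v) [AddCommGroup V] [Module k V] [LieRingModule G V] [LieModule k G V]
    [FiniteDimensional k V] [LieModule.IsIrreducible k G V] : Rep.{v} k G :=
  Quotient.mk _ ⟨V⟩

end Classes

section Trivial

universe u

variable (k : Type u) (G : Type*) [Field k] [LieRing G] [LieAlgebra k G]

instance : FiniteDimensional k (TrivialLieModule k G k) :=
  Module.Finite.equiv (TrivialLieModule.equiv k G k).symm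

instance : LieModule.IsIrreducible k G (TrivialLieModule k G k) := by
  have : Nontrivial (TrivialLieModule k G k) :=
    (TrivialLieModule.equiv k G k).toEquiv.nontrivial
  apply LieModule.IsIrreducible.mk
  intro N hN
  obtain ⟨a, ha, ha0⟩ : ∃ a ∈ N, a ≠ 0 := by
    by_contra! h
    exact hN ((LieSubmodule.eq_bot_iff N).mpr h)
  rw [eq_top_iff]
  intro b _
  have h0 : TrivialLieModule.equiv k G k a ≠ 0 := by simpa using ha0
  have hb : b = (TrivialLieModule.equiv k G k b / TrivialLieModule.equiv k G k a) • a := by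
    apply (TrivialLieModule.equiv k G k).injective
    rw [map_smul, smul_eq_mul, div_mul_cancel₀ _ h0]
  rw [hb]
  exact N.smul_mem _ ha

/-- The class `[k₀]` of the trivial one-dimensional module. -/
def Rep.trivial : Rep.{u} k G := Rep.mk k G (TrivialLieModule k G k)

end Trivial

/-- A finite-dimensional Lie algebra over a field of characteristic zero is reductive if its
radical is its centre. -/
def IsReductive (k G : Type*) [Field k] [LieRing G] [LieAlgebra k G] : Prop :=
  FiniteDimensional k G ∧ LieAlgebra.radical k G = LieAlgebra.center k G

end Modules

/-! ### The action of `Γ` on maximal ideals -/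

section MaxSpec

variable {Γ S : Type*} [Group Γ] [CommRing S] [MulSemiringAction Γ S]

/-- `γ • M` is the image `{γ • s | s ∈ M}` of `M`. -/
instance : MulAction Γ (MaximalSpectrum S) where
  smul γ M := ⟨M.asIdeal.comap (MulSemiringAction.toRingEquiv Γ S γ⁻¹),
    haveI := M.isMaximal
    Ideal.comap_isMaximal_of_equiv (MulSemiringAction.toRingEquiv Γ S γ⁻¹)⟩
  one_smul M := by
    apply MaximalSpectrum.ext
    ext s
    change (1 : Γ)⁻¹ • s ∈ M.asIdeal ↔ _
    rw [inv_one, one_smul]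
  mul_smul γ δ M := by
    apply MaximalSpectrum.ext
    ext s
    change (γ * δ)⁻¹ • s ∈ M.asIdeal ↔ δ⁻¹ • γ⁻¹ • s ∈ M.asIdeal
    rw [mul_inv_rev, mul_smul]

theorem mem_smul_iff (γ : Γ) (M : MaximalSpectrum S) (s : S) :
    s ∈ (γ • M).asIdeal ↔ γ⁻¹ • s ∈ M.asIdeal := Iff.rfl

/-- `M : Fin r → X` is a set of representatives of the `Γ`-orbits in the (`Γ`-stable) set `T`. -/
def IsOrbitRepresentatives (Γ : Type*) {X : Type*} [Group Γ] [MulAction Γ X] {r : ℕ}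
    (M : Fin r → X) (T : Set X) : Prop :=
  (∀ i, M i ∈ T) ∧ ∀ N ∈ T, ∃! i, N ∈ MulAction.orbit Γ (M i)

end MaxSpec

/-! ### Evaluation at a maximal ideal -/

section Evaluation

variable {k S g : Type*} [Field k] [IsAlgClosed k] [CommRing S] [Algebra k S]
  [Algebra.FiniteType k S] [LieRing g] [LieAlgebra k g]

theorem algebraMap_residue_bijective (M : MaximalSpectrum S) :
    Function.Bijective (algebraMap k (S ⧸ M.asIdeal)) := by
  have := M.isMaximal
  let : Field (S ⧸ M.asIdeal) := Ideal.Quotient.field M.asIdeal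
  have : Module.Finite k (S ⧸ M.asIdeal) := finite_of_finite_type_of_isJacobsonRing k _
  exact IsAlgClosed.algebraMap_bijective_of_isIntegral

/-- The reduction `s ↦ s(M) ∈ k` modulo `M`, where `S / M` is identified with `k`. -/
def evalPoint (M : MaximalSpectrum S) : S →ₐ[k] k :=
  (AlgEquiv.ofBijective (Algebra.ofId k (S ⧸ M.asIdeal))
    (algebraMap_residue_bijective M)).symm.toAlgHom.comp (Ideal.Quotient.mkₐ k M.asIdeal)

theorem evalPoint_spec (M : MaximalSpectrum S) (s : S) :
    s - algebraMap k S (evalPoint M s) ∈ M.asIdeal := by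
  rw [← Ideal.Quotient.mk_eq_mk_iff_sub_mem]
  have h := (AlgEquiv.ofBijective (Algebra.ofId k (S ⧸ M.asIdeal))
    (algebraMap_residue_bijective M)).apply_symm_apply (Ideal.Quotient.mk M.asIdeal s)
  exact h.symm

theorem evalPoint_eq_of_mem (M : MaximalSpectrum S) (s : S) (a : k)
    (h : s - algebraMap k S a ∈ M.asIdeal) : evalPoint M s = a := by
  apply (algebraMap_residue_bijective (k := k) M).1
  have h1 := Ideal.Quotient.mk_eq_mk_iff_sub_mem _ _ |>.mpr (evalPoint_spec (k := k) M s)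
  have h2 := Ideal.Quotient.mk_eq_mk_iff_sub_mem _ _ |>.mpr h
  exact h1.symm.trans h2

/-- The evaluation `ev_M : g ⊗ S → g`, `x ⊗ s ↦ s(M) x`. -/
def ev (M : MaximalSpectrum S) : S ⊗[k] g →ₗ⁅k⁆ g where
  toLinearMap := (TensorProduct.lid k g).toLinearMap ∘ₗ (evalPoint M).toLinearMap.rTensor g
  map_lie' := by
    intro x y
    induction x with
    | zero => simp
    | add x x' hx hx' => simp_all [add_lie]
    | tmul s a =>
      induction y with
      | zero => simp
      | add y y' hy hy' => simp_all [lie_add]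
      | tmul t b => simp [smul_smul, mul_comm]

theorem ev_tmul (M : MaximalSpectrum S) (s : S) (x : g) :
    ev M (s ⊗ₜ[k] x) = evalPoint (k := k) M s • x := rfl

theorem ev_smul (M : MaximalSpectrum S) (s : S) (z : S ⊗[k] g) :
    ev M (s • z) = evalPoint (k := k) M s • ev M z := by
  induction z with
  | zero => simp
  | add x y hx hy => rw [smul_add, map_add, map_add, hx, hy, smul_add]
  | tmul t x => rw [TensorProduct.smul_tmul', ev_tmul, ev_tmul, smul_eq_mul, map_mul, mul_smul]

end Evaluation

/-! ### Twisted current algebras -/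

section Twisted

variable {k S g Γ : Type*} [Field k] [CommRing S] [Algebra k S]
  [LieRing g] [LieAlgebra k g] [Group Γ] [MulSemiringAction Γ S] [SMulCommClass Γ k S]

variable (k S g) in
/-- The action `γ (x ⊗ s) = x ⊗ γ s` of `Γ` on the current algebra `g ⊗ S`. -/
def coeffAct (γ : Γ) : S ⊗[k] g →ₗ⁅k⁆ S ⊗[k] g :=
  LieAlgebra.ExtendScalars.map (MulSemiringAction.toAlgHom k S γ) LieHom.id

variable (k S g Γ) in
/-- Crossed homomorphisms `u` from `Γ` to the group of `S`-Lie algebra automorphisms of `g ⊗ S`,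
on which `Γ` acts by conjugation: `u_{γδ} = u_γ ∘ (γ ∘ u_δ ∘ γ⁻¹)`. -/
structure CrossedHom where
  toFun : Γ → (S ⊗[k] g ≃ₗ⁅S⁆ S ⊗[k] g)
  map_mul' : ∀ (γ δ : Γ) (z : S ⊗[k] g),
    toFun (γ * δ) z = toFun γ (coeffAct k S g γ (toFun δ (coeffAct k S g γ⁻¹ z)))

variable (u : CrossedHom k S g Γ)

/-- The twisted action `x ⊗ s ↦ u_γ (x ⊗ γ s)` of `Γ` on `g ⊗ S`. -/
def CrossedHom.act (γ : Γ) : S ⊗[k] g →ₗ⁅k⁆ S ⊗[k] g where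
  toLinearMap := ((u.toFun γ).toLinearEquiv.toLinearMap.restrictScalars k) ∘ₗ
    (coeffAct k S g γ : S ⊗[k] g →ₗ[k] S ⊗[k] g)
  map_lie' := by
    intro x y
    change u.toFun γ (coeffAct k S g γ ⁅x, y⁆) =
      ⁅u.toFun γ (coeffAct k S g γ x), u.toFun γ (coeffAct k S g γ y)⁆
    rw [LieHom.map_lie, LieEquiv.map_lie]

theorem CrossedHom.act_apply (γ : Γ) (z : S ⊗[k] g) :
    u.act γ z = u.toFun γ (coeffAct k S g γ z) := rfl

theorem coeffAct_mul (γ δ : Γ) (z : S ⊗[k] g) :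
    coeffAct k S g (γ * δ) z = coeffAct k S g γ (coeffAct k S g δ z) := by
  induction z with
  | zero => simp
  | add x y hx hy => simp [hx, hy]
  | tmul s x => simp [coeffAct, mul_smul]

theorem coeffAct_one (z : S ⊗[k] g) : coeffAct k S g (1 : Γ) z = z := by
  induction z with
  | zero => simp
  | add x y hx hy => simp [hx, hy]
  | tmul s x => simp [coeffAct]

theorem CrossedHom.act_mul (γ δ : Γ) (z : S ⊗[k] g) :
    u.act (γ * δ) z = u.act γ (u.act δ z) := by
  rw [act_apply, act_apply, act_apply, u.map_mul', ← coeffAct_mul, inv_mul_cancel_left]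

theorem CrossedHom.act_one (z : S ⊗[k] g) : u.act 1 z = z := by
  have h : u.act 1 (u.act 1 z) = u.act 1 z := by rw [← u.act_mul, one_mul]
  have hinj : Function.Injective (u.act 1) := by
    intro a b hab
    rw [act_apply, act_apply, coeffAct_one, coeffAct_one] at hab
    exact (u.toFun 1).injective hab
  exact hinj h

theorem CrossedHom.act_smul (γ : Γ) (s : S) (z : S ⊗[k] g) :
    u.act γ (s • z) = (γ • s) • u.act γ z := by
  have h : coeffAct k S g γ (s • z) = (γ • s) • coeffAct k S g γ z := by
    induction z with
    | zero => simp
    | add x y hx hy => simp [hx, hy]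
    | tmul t x => simp [coeffAct, TensorProduct.smul_tmul', smul_mul']
  rw [act_apply, act_apply, h]
  exact (u.toFun γ).toLinearEquiv.map_smul _ _

/-- The twisted current algebra `(g ⊗ S)^Γ`. -/
def CrossedHom.algebra : LieSubalgebra k (S ⊗[k] g) where
  carrier := {z | ∀ γ, u.act γ z = z}
  add_mem' := by
    intro a b ha hb γ
    rw [map_add, ha γ, hb γ]
  zero_mem' := fun γ => map_zero _
  smul_mem' := by
    intro t a ha γ
    rw [map_smul, ha γ]
  lie_mem' := by
    intro a b ha hb γ
    rw [LieHom.map_lie, ha γ, hb γ]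

variable [IsAlgClosed k] [Algebra.FiniteType k S]

theorem evalPoint_smul (γ : Γ) (M : MaximalSpectrum S) (s : S) :
    evalPoint (k := k) M (γ • s) = evalPoint (γ⁻¹ • M) s := by
  symm
  apply evalPoint_eq_of_mem
  rw [mem_smul_iff, inv_inv, smul_sub, smul_algebraMap]
  exact evalPoint_spec M (γ • s)

/-- The automorphism `γ(M) : x ↦ (γ (x ⊗ 1))(M)` of `g`, as a homomorphism. -/
def CrossedHom.atPoint (γ : Γ) (M : MaximalSpectrum S) : g →ₗ⁅k⁆ g where
  toFun x := ev M (u.act γ (1 ⊗ₜ x))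
  map_add' x y := by rw [TensorProduct.tmul_add, map_add, map_add]
  map_smul' t x := by rw [TensorProduct.tmul_smul, map_smul, map_smul, RingHom.id_apply]
  map_lie' := by
    intro x y
    have h : (1 : S) ⊗ₜ[k] ⁅x, y⁆ = ⁅(1 : S) ⊗ₜ[k] x, (1 : S) ⊗ₜ[k] y⁆ := by simp
    change ev M (u.act γ (1 ⊗ₜ ⁅x, y⁆)) = _
    rw [h, LieHom.map_lie, LieHom.map_lie]

theorem CrossedHom.ev_act (γ : Γ) (M : MaximalSpectrum S) (z : S ⊗[k] g) :
    ev M (u.act γ z) = u.atPoint γ M (ev (γ⁻¹ • M) z) := by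
  induction z with
  | zero => simp
  | add x y hx hy => simp only [map_add, hx, hy]
  | tmul s x =>
    have h : s ⊗ₜ[k] x = s • ((1 : S) ⊗ₜ[k] x) := by
      rw [TensorProduct.smul_tmul', smul_eq_mul, mul_one]
    rw [h, u.act_smul, ev_smul, ev_smul, evalPoint_smul, map_smul, ev_tmul, map_one, one_smul]
    rfl

theorem CrossedHom.atPoint_mul (γ δ : Γ) (M : MaximalSpectrum S) (x : g) :
    u.atPoint (γ * δ) M x = u.atPoint γ M (u.atPoint δ (γ⁻¹ • M) x) := by
  change ev M (u.act (γ * δ) (1 ⊗ₜ x)) = _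
  rw [u.act_mul, u.ev_act]
  rfl

theorem CrossedHom.atPoint_one (M : MaximalSpectrum S) (x : g) : u.atPoint 1 M x = x := by
  change ev M (u.act 1 (1 ⊗ₜ x)) = x
  rw [u.act_one, ev_tmul, map_one, one_smul]

/-- The automorphism `γ(M)` of `g`. -/
def CrossedHom.autAt (γ : Γ) (M : MaximalSpectrum S) : g ≃ₗ⁅k⁆ g :=
  { u.atPoint γ M with
    invFun := u.atPoint γ⁻¹ (γ⁻¹ • M)
    left_inv := by
      intro x
      change u.atPoint γ⁻¹ (γ⁻¹ • M) (u.atPoint γ M x) = x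
      have h := u.atPoint_mul γ⁻¹ γ (γ⁻¹ • M) x
      rw [inv_inv, smul_inv_smul, inv_mul_cancel, u.atPoint_one] at h
      exact h.symm
    right_inv := by
      intro x
      change u.atPoint γ M (u.atPoint γ⁻¹ (γ⁻¹ • M) x) = x
      rw [← u.atPoint_mul, mul_inv_cancel, u.atPoint_one] }

theorem CrossedHom.autAt_apply (γ : Γ) (M : MaximalSpectrum S) (x : g) :
    u.autAt γ M x = u.atPoint γ M x := rfl

theorem CrossedHom.autAt_symm_apply (γ : Γ) (M : MaximalSpectrum S) (x : g) :
    (u.autAt γ M).symm x = u.atPoint γ⁻¹ (γ⁻¹ • M) x := rfl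

/-- `g^M = {x ∈ g | γ(M) x = x for all γ ∈ Γ with γ M = M}`. -/
def CrossedHom.fix (M : MaximalSpectrum S) : LieSubalgebra k g where
  carrier := {x | ∀ γ : Γ, γ • M = M → u.autAt γ M x = x}
  add_mem' := by
    intro a b ha hb γ hγ
    rw [map_add, ha γ hγ, hb γ hγ]
  zero_mem' := fun γ _ => map_zero _
  smul_mem' := by
    intro t a ha γ hγ
    rw [map_smul, ha γ hγ]
  lie_mem' := by
    intro a b ha hb γ hγ
    rw [LieEquiv.map_lie, ha γ hγ, hb γ hγ]

/-- The restriction `(g ⊗ S)^Γ → g^M` of `ev_M`. -/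
def CrossedHom.evFix (M : MaximalSpectrum S) : u.algebra →ₗ⁅k⁆ u.fix M where
  toFun z := ⟨ev M (z : S ⊗[k] g), by
    intro γ hγ
    have h := u.ev_act γ M (z : S ⊗[k] g)
    rw [z.2 γ, inv_smul_eq_iff.mpr hγ.symm] at h
    exact h.symm⟩
  map_add' x y := Subtype.ext (map_add (ev M) (x : S ⊗[k] g) y)
  map_smul' t x := Subtype.ext (map_smul (ev M) t (x : S ⊗[k] g))
  map_lie' := fun {x y} => Subtype.ext (LieHom.map_lie (ev M) (x : S ⊗[k] g) y)

theorem CrossedHom.autAt_symm_mem (γ : Γ) (M : MaximalSpectrum S) {x : g}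
    (hx : x ∈ u.fix (γ • M)) : (u.autAt γ (γ • M)).symm x ∈ u.fix M := by
  intro δ hδ
  rw [u.autAt_symm_apply, inv_smul_smul, u.autAt_apply]
  have h1 := u.atPoint_mul δ γ⁻¹ M x
  rw [inv_smul_eq_iff.mpr hδ.symm] at h1
  have h2 := u.atPoint_mul γ⁻¹ (γ * δ * γ⁻¹) M x
  rw [inv_inv] at h2
  have h3 : u.atPoint (γ * δ * γ⁻¹) (γ • M) x = x := by
    apply hx
    rw [mul_smul, mul_smul, inv_smul_smul, hδ]
  rw [h3] at h2
  rw [← h1, ← h2]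
  congr 2
  group

theorem CrossedHom.autAt_mem (γ : Γ) (M : MaximalSpectrum S) {x : g}
    (hx : x ∈ u.fix M) : u.autAt γ (γ • M) x ∈ u.fix (γ • M) := by
  have h := u.autAt_symm_mem γ⁻¹ (γ • M) (x := x) (by rwa [inv_smul_smul])
  rw [u.autAt_symm_apply, inv_smul_smul, inv_inv] at h
  exact h

/-- The isomorphism `γ(N)⁻¹ : g^N → g^M` for `N = γ M`. -/
def CrossedHom.untwist (γ : Γ) (M N : MaximalSpectrum S) (h : γ • M = N) :
    u.fix N →ₗ⁅k⁆ u.fix M where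
  toFun x := ⟨(u.autAt γ N).symm x, by subst h; exact u.autAt_symm_mem γ M x.2⟩
  map_add' x y := Subtype.ext (map_add (u.autAt γ N).symm (x : g) y)
  map_smul' t x := Subtype.ext (map_smul (u.autAt γ N).symm t (x : g))
  map_lie' := fun {x y} => Subtype.ext (LieEquiv.map_lie (u.autAt γ N).symm (x : g) y)

theorem CrossedHom.untwist_surjective (γ : Γ) (M N : MaximalSpectrum S) (h : γ • M = N) :
    Function.Surjective (u.untwist γ M N h) := by
  subst h
  intro y
  exact ⟨⟨u.autAt γ (γ • M) y, u.autAt_mem γ M y.2⟩,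
    Subtype.ext ((u.autAt γ (γ • M)).symm_apply_apply y)⟩

/-- `γ(N)⁻¹ : g^N → g^M` depends only on `M` and `N = γ M`. -/
theorem CrossedHom.untwist_eq (γ δ : Γ) (M N : MaximalSpectrum S) (h : γ • M = N)
    (h' : δ • M = N) : u.untwist γ M N h = u.untwist δ M N h' := by
  ext x
  change (u.autAt γ N).symm x = (u.autAt δ N).symm x
  rw [u.autAt_symm_apply, u.autAt_symm_apply, inv_smul_eq_iff.mpr h.symm,
    inv_smul_eq_iff.mpr h'.symm]
  have h2 := u.atPoint_mul γ⁻¹ (γ * δ⁻¹) M x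
  have h3 : u.atPoint (γ * δ⁻¹) N x = x := by
    apply x.2
    rw [mul_smul, inv_smul_eq_iff.mpr h'.symm, h]
  rw [inv_inv, h, h3, inv_mul_cancel_left] at h2
  exact h2.symm

end Twisted

/-! ### Evaluation modules and their sections -/

section Sections

universe u

variable {k : Type u} {S g Γ : Type*} [Field k] [IsAlgClosed k] [CommRing S] [Algebra k S]
  [Algebra.FiniteType k S] [LieRing g] [LieAlgebra k g] [Group Γ] [MulSemiringAction Γ S]
  [SMulCommClass Γ k S] (u : CrossedHom k S g Γ)

/-- A module is an evaluation module if the action factors through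
`ev_M : L → ev_{M₁}(L) ⊕ ⋯ ⊕ ev_{M_r}(L)` for finitely many maximal ideals `M₁, …, M_r`. -/
def IsEvaluationModule (E : Type*) [AddCommGroup E] [LieRingModule u.algebra E] : Prop :=
  ∃ T : Finset (MaximalSpectrum S), ∀ z : u.algebra,
    (∀ M ∈ T, ev M (z : S ⊗[k] g) = 0) → ∀ e : E, ⁅z, e⁆ = 0

/-- The `L`-module `E₁ ⊗ ⋯ ⊗ E_r`, where `L` acts on the `g^{M_i}`-module `E_i` through
`ev_{M_i}`. -/
abbrev EvalTensor {r : ℕ} (M : Fin r → MaximalSpectrum S) (E : Fin r → Type u)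
    [∀ i, AddCommGroup (E i)] [∀ i, Module k (E i)] [∀ i, LieRingModule (u.fix (M i)) (E i)]
    [∀ i, LieModule k (u.fix (M i)) (E i)] : Type u :=
  ⨂[k] i, Pullback (u.evFix (M i)) (E i)

/-- Sections of the bundle `⊔_M Rep(g^M) → Max S`. -/
abbrev RepSection : Type _ := ∀ M : MaximalSpectrum S, Rep.{u} k (u.fix M)

/-- `supp f = {M | f(M) ≠ [k₀]}`. -/
def RepSection.supp {u : CrossedHom k S g Γ} (f : RepSection u) : Set (MaximalSpectrum S) :=
  {M | f M ≠ Rep.trivial k (u.fix M)}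

open Classical in
/-- The section which sends `N = γ M_i` to `[(E_i, ρ_i ∘ γ(N)⁻¹)]`, and `N` to `[k₀]` if it is not
in the orbit of any `M_i`. The value does not depend on the choice of `γ` (`untwist_eq`), nor on
the choice of `i` if the `M_i` are in distinct orbits. -/
def sectionOf {r : ℕ} (M : Fin r → MaximalSpectrum S) (E : Fin r → Type u)
    [∀ i, AddCommGroup (E i)] [∀ i, Module k (E i)] [∀ i, LieRingModule (u.fix (M i)) (E i)]
    [∀ i, LieModule k (u.fix (M i)) (E i)] [∀ i, FiniteDimensional k (E i)]
    [∀ i, LieModule.IsIrreducible k (u.fix (M i)) (E i)] : RepSection u := fun N =>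
  if h : ∃ p : Fin r × Γ, p.2 • M p.1 = N then
    haveI := Pullback.isIrreducible (u.untwist h.choose.2 (M h.choose.1) N h.choose_spec)
      (E h.choose.1) (u.untwist_surjective _ _ _ _)
    Rep.mk k (u.fix N)
      (Pullback (u.untwist h.choose.2 (M h.choose.1) N h.choose_spec) (E h.choose.1))
  else Rep.trivial k (u.fix N)

/-- `f = f_E`: the module `E` is isomorphic to `E₁ ⊗ ⋯ ⊗ E_r` for simple `g^{M_i}`-modules `E_i`,
with `M₁, …, M_r` in distinct `Γ`-orbits, and `f` is the section attached to these data. -/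
def IsSectionOf (E : Type u) [AddCommGroup E] [Module k E] [LieRingModule u.algebra E]
    [LieModule k u.algebra E] (f : RepSection u) : Prop :=
  ∃ (r : ℕ) (M : Fin r → MaximalSpectrum S) (V : ∀ i, SimpleModule.{u} k (u.fix (M i))),
    (∀ i j, M i ∈ MulAction.orbit Γ (M j) → i = j) ∧
    Nonempty (E ≃ₗ⁅k, u.algebra⁆ EvalTensor u M fun i => (V i).V) ∧
    f = sectionOf u M fun i => (V i).V

variable (k) in
/-- The dual `(L/L')*` of the abelianization of `L`. -/
abbrev AbDual (L : Type*) [LieRing L] [LieAlgebra k L] : Type _ :=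
  Module.Dual k (L ⧸ ⁅(⊤ : LieIdeal k L), (⊤ : LieIdeal k L)⁆)

end Sections

end TwistedCurrent

end

open TwistedCurrent

universe w

/-!
Write `L` for the twisted current algebra. The extensions of `E` by `F` are classified by
`H¹(L, Hom(E, F))`, and `Hom(E, F)` is the tensor product of the modules
`V i = Hom(E i, F i)`, which live at points in distinct orbits.

The algebra `L` is a Lie algebra over the ring of invariants of `S`. Given points in distinct
orbits, some invariant `a` has the value `1` on one of the orbits and `0` on the others, so that
multiplication by `a` is an element of the centroid of `L` that acts as the identity on one factor
`V` of a tensor product `V ⊗ W` and as zero on the other (`separated_pullback`). If in addition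
neither `V` nor `W` has invariants, then `H¹(L, V ⊗ W) = 0` (`h1_tensor_subsingleton`). This is a
form of the Künneth formula, though `L` is not a product: the centroid shows that a derivation
cannot see the part of `L` which vanishes at both points.

By Schur's lemma `V i` has no invariants if `E i` and `F i` are not isomorphic. If they are, then
the trace splits off a trivial module, `V i = k₀ ⊕ V' i`, and `V' i` has no invariants
(`exists_trivial_split_hom`); the same holds for partial tensor products. Expanding the tensor
product with these decompositions and dropping the summands whose cohomology vanishes leaves

* nothing, if two of the `V i` have no invariants (`h1_hom_piTensor_subsingleton`),
* `H¹(L, V j)`, if only `V j` has no invariants (`nonempty_h1_hom_piTensor_equiv`),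
* `H¹(L, k₀) ⊕ ⨁ H¹(L, V' i)`, if all `E i` and `F i` are isomorphic
  (`nonempty_h1_hom_piTensor_equiv_prod`),

where `H¹(L, k₀) = (L/L')*`. In the last case `H¹(L, V i) = H¹(L, k₀) ⊕ H¹(L, V' i)` for each of
the `r` indices, which accounts for the `r - 1` additional copies of `(L/L')*`.

To read off from the sections which of the `E i` and `F i` are isomorphic, two facts are needed.
The evaluations `L → g^M` are onto (`CrossedHom.evFix_surjective`), so that isomorphism over
`g^M` and over `L` is the same. The section of an evaluation module depends only on the module
(`sectionOf_unique`): the centroid isolates the factor at a given point, and the identity map,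
being invariant, forces two such factors to be isomorphic.
-/

namespace TwistedCurrent

noncomputable section

/-! ### Functoriality of first cohomology -/

section Cohomology

variable {k L : Type*} [Field k] [LieRing L] [LieAlgebra k L]
  {V W X A B : Type*}
  [AddCommGroup V] [Module k V] [LieRingModule L V] [LieModule k L V]
  [AddCommGroup W] [Module k W] [LieRingModule L W] [LieModule k L W]
  [AddCommGroup X] [Module k X] [LieRingModule L X] [LieModule k L X]
  [AddCommGroup A] [Module k A] [LieRingModule L A] [LieModule k L A]
  [AddCommGroup B] [Module k B] [LieRingModule L B] [LieModule k L B]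

/-- Composition of a derivation with a homomorphism of modules. -/
def derivationComp (f : V →ₗ⁅k, L⁆ W) : LieDerivation k L V →ₗ[k] LieDerivation k L W where
  toFun D :=
    { toLinearMap := (f : V →ₗ[k] W) ∘ₗ (D : L →ₗ[k] V)
      leibniz' := fun x y => by
        change f (D ⁅x, y⁆) = ⁅x, f (D y)⁆ - ⁅y, f (D x)⁆
        rw [LieDerivation.apply_lie_eq_sub, map_sub, LieModuleHom.map_lie, LieModuleHom.map_lie] }
  map_add' D D' := by
    ext x
    exact map_add f (D x) (D' x)
  map_smul' t D := by
    ext x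
    exact map_smul f t (D x)

/-- The map `H¹(L, V) → H¹(L, W)` induced by a homomorphism `V → W`. -/
def H1.map (f : V →ₗ⁅k, L⁆ W) : H1 k L V →ₗ[k] H1 k L W :=
  Submodule.mapQ _ _ (derivationComp f) (by
    rintro _ ⟨v, rfl⟩
    refine ⟨f v, ?_⟩
    ext x
    exact (LieModuleHom.map_lie f x v).symm)

theorem H1.map_mk (f : V →ₗ⁅k, L⁆ W) (D : LieDerivation k L V) :
    H1.map f (Submodule.Quotient.mk D) = Submodule.Quotient.mk (derivationComp f D) := rfl

theorem H1.map_map (g : W →ₗ⁅k, L⁆ X) (f : V →ₗ⁅k, L⁆ W) (a : H1 k L V) :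
    H1.map g (H1.map f a) = H1.map (g.comp f) a := by
  induction a using Submodule.Quotient.induction_on with
  | _ D => rfl

theorem H1.map_eq_self (f : V →ₗ⁅k, L⁆ V) (hf : ∀ v, f v = v) (a : H1 k L V) :
    H1.map f a = a := by
  induction a using Submodule.Quotient.induction_on with
  | _ D =>
    rw [H1.map_mk]
    congr 1
    ext x
    exact hf _

theorem H1.map_eq_zero (f : V →ₗ⁅k, L⁆ W) (hf : ∀ v, f v = 0) (a : H1 k L V) :
    H1.map f a = 0 := by
  induction a using Submodule.Quotient.induction_on with
  | _ D =>
    rw [H1.map_mk, ← Submodule.Quotient.mk_zero]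
    congr 1
    ext x
    exact hf _

theorem H1.map_add_map (f g h : V →ₗ⁅k, L⁆ W) (hf : ∀ v, f v + g v = h v) (a : H1 k L V) :
    H1.map f a + H1.map g a = H1.map h a := by
  induction a using Submodule.Quotient.induction_on with
  | _ D =>
    rw [H1.map_mk, H1.map_mk, H1.map_mk, ← Submodule.Quotient.mk_add]
    congr 1
    ext x
    exact hf _

/-- Isomorphic modules have isomorphic first cohomology. -/
def H1.congr (e : V ≃ₗ⁅k, L⁆ W) : H1 k L V ≃ₗ[k] H1 k L W :=
  LinearEquiv.ofLinearMap (H1.map (e : V →ₗ⁅k, L⁆ W)) (H1.map (e.symm : W →ₗ⁅k, L⁆ V))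
    (by
      refine LinearMap.ext fun a => ?_
      change H1.map _ (H1.map _ a) = a
      rw [H1.map_map]
      exact H1.map_eq_self _ (fun v => e.apply_symm_apply v) a)
    (by
      refine LinearMap.ext fun a => ?_
      change H1.map _ (H1.map _ a) = a
      rw [H1.map_map]
      exact H1.map_eq_self _ (fun v => e.symm_apply_apply v) a)

variable (k L V A B) in
/-- A decomposition of the module `V` as a direct sum of `A` and `B`, given by the inclusions and
the projections. -/
structure Biproduct where
  inl : A →ₗ⁅k, L⁆ V
  inr : B →ₗ⁅k, L⁆ V
  fst : V →ₗ⁅k, L⁆ A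
  snd : V →ₗ⁅k, L⁆ B
  fst_inl : ∀ a, fst (inl a) = a
  snd_inr : ∀ b, snd (inr b) = b
  fst_inr : ∀ b, fst (inr b) = 0
  snd_inl : ∀ a, snd (inl a) = 0
  total : ∀ v, inl (fst v) + inr (snd v) = v

/-- First cohomology is additive in the module. -/
def Biproduct.h1Equiv (d : Biproduct k L V A B) : H1 k L V ≃ₗ[k] H1 k L A × H1 k L B :=
  LinearEquiv.ofLinearMap ((H1.map d.fst).prod (H1.map d.snd))
    ((H1.map d.inl).coprod (H1.map d.inr))
    (by
      refine LinearMap.ext fun p => Prod.ext ?_ ?_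
      · change H1.map d.fst (H1.map d.inl p.1 + H1.map d.inr p.2) = p.1
        rw [map_add, H1.map_map, H1.map_map, H1.map_eq_self _ d.fst_inl,
          H1.map_eq_zero _ d.fst_inr, add_zero]
      · change H1.map d.snd (H1.map d.inl p.1 + H1.map d.inr p.2) = p.2
        rw [map_add, H1.map_map, H1.map_map, H1.map_eq_self (d.snd.comp d.inr) d.snd_inr,
          H1.map_eq_zero (d.snd.comp d.inl) d.snd_inl, zero_add])
    (by
      refine LinearMap.ext fun a => ?_
      change H1.map d.inl (H1.map d.fst a) + H1.map d.inr (H1.map d.snd a) = a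
      rw [H1.map_map, H1.map_map, H1.map_add_map _ _ LieModuleHom.id d.total]
      exact H1.map_eq_self _ (fun _ => rfl) a)

/-- A split homomorphism `V → A` exhibits `V` as the direct sum of `A` and the kernel. -/
def Biproduct.ofSplit (i : A →ₗ⁅k, L⁆ V) (p : V →ₗ⁅k, L⁆ A) (h : ∀ a, p (i a) = a) :
    Biproduct k L V A p.ker where
  inl := i
  inr := p.ker.incl
  fst := p
  snd :=
    { toFun := fun v => ⟨v - i (p v), by
        rw [LieModuleHom.mem_ker, map_sub, h, sub_self]⟩
      map_add' := fun v w => Subtype.ext (by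
        change v + w - i (p (v + w)) = (v - i (p v)) + (w - i (p w))
        rw [map_add, map_add]; abel)
      map_smul' := fun t v => Subtype.ext (by
        change t • v - i (p (t • v)) = t • (v - i (p v))
        rw [map_smul, map_smul, smul_sub])
      map_lie' := fun {x v} => Subtype.ext (by
        change ⁅x, v⁆ - i (p ⁅x, v⁆) = ⁅x, v - i (p v)⁆
        rw [LieModuleHom.map_lie, LieModuleHom.map_lie, lie_sub]) }
  fst_inl := h
  snd_inr b := Subtype.ext (by
    change (b : V) - i (p b) = b
    rw [LieModuleHom.mem_ker.mp b.2, map_zero, sub_zero])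
  fst_inr b := LieModuleHom.mem_ker.mp b.2
  snd_inl a := Subtype.ext (by
    change i a - i (p (i a)) = 0
    rw [h, sub_self])
  total v := by
    change i (p v) + (v - i (p v)) = v
    abel

/-- Tensoring a direct sum decomposition on the right. -/
def Biproduct.rTensor (d : Biproduct k L V A B) (W : Type*) [AddCommGroup W] [Module k W]
    [LieRingModule L W] [LieModule k L W] :
    Biproduct k L (V ⊗[k] W) (A ⊗[k] W) (B ⊗[k] W) where
  inl := TensorProduct.LieModule.map d.inl LieModuleHom.id
  inr := TensorProduct.LieModule.map d.inr LieModuleHom.id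
  fst := TensorProduct.LieModule.map d.fst LieModuleHom.id
  snd := TensorProduct.LieModule.map d.snd LieModuleHom.id
  fst_inl a := by
    induction a with
    | zero => simp
    | add x y hx hy => rw [map_add, map_add, hx, hy]
    | tmul a w => simp [d.fst_inl]
  snd_inr a := by
    induction a with
    | zero => simp
    | add x y hx hy => rw [map_add, map_add, hx, hy]
    | tmul a w => simp [d.snd_inr]
  fst_inr a := by
    induction a with
    | zero => simp
    | add x y hx hy => rw [map_add, map_add, hx, hy, add_zero]
    | tmul a w => simp [d.fst_inr]
  snd_inl a := by
    induction a with
    | zero => simp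
    | add x y hx hy => rw [map_add, map_add, hx, hy, add_zero]
    | tmul a w => simp [d.snd_inl]
  total v := by
    induction v with
    | zero => simp
    | add x y hx hy =>
      rw [map_add, map_add, map_add, map_add, add_add_add_comm, hx, hy]
    | tmul v w => simp [← TensorProduct.add_tmul, d.total]

/-- Tensoring a direct sum decomposition on the left. -/
def Biproduct.lTensor (d : Biproduct k L V A B) (W : Type*) [AddCommGroup W] [Module k W]
    [LieRingModule L W] [LieModule k L W] :
    Biproduct k L (W ⊗[k] V) (W ⊗[k] A) (W ⊗[k] B) where
  inl := TensorProduct.LieModule.map LieModuleHom.id d.inl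
  inr := TensorProduct.LieModule.map LieModuleHom.id d.inr
  fst := TensorProduct.LieModule.map LieModuleHom.id d.fst
  snd := TensorProduct.LieModule.map LieModuleHom.id d.snd
  fst_inl a := by
    induction a with
    | zero => simp
    | add x y hx hy => rw [map_add, map_add, hx, hy]
    | tmul a w => simp [d.fst_inl]
  snd_inr a := by
    induction a with
    | zero => simp
    | add x y hx hy => rw [map_add, map_add, hx, hy]
    | tmul a w => simp [d.snd_inr]
  fst_inr a := by
    induction a with
    | zero => simp
    | add x y hx hy => rw [map_add, map_add, hx, hy, add_zero]
    | tmul a w => simp [d.fst_inr]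
  snd_inl a := by
    induction a with
    | zero => simp
    | add x y hx hy => rw [map_add, map_add, hx, hy, add_zero]
    | tmul a w => simp [d.snd_inl]
  total v := by
    induction v with
    | zero => simp
    | add x y hx hy =>
      rw [map_add, map_add, map_add, map_add, add_add_add_comm, hx, hy]
    | tmul v w => simp [← TensorProduct.tmul_add, d.total]

variable (k L V) in
/-- `k₀ ⊗ V ≅ V`. -/
def trivialTensor : TrivialLieModule k L k ⊗[k] V ≃ₗ⁅k, L⁆ V where
  __ := (TrivialLieModule.equiv k L k).rTensor V ≪≫ₗ TensorProduct.lid k V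
  map_lie' := fun {x v} => by
    change ((TrivialLieModule.equiv k L k).rTensor V ≪≫ₗ TensorProduct.lid k V) ⁅x, v⁆ =
      ⁅x, ((TrivialLieModule.equiv k L k).rTensor V ≪≫ₗ TensorProduct.lid k V) v⁆
    induction v with
    | zero => simp
    | add v w hv hw => rw [lie_add, map_add, map_add, lie_add, hv, hw]
    | tmul t v => simp [trivial_lie_zero]

variable (k L V) in
/-- `V ⊗ k₀ ≅ V`. -/
def tensorTrivial : V ⊗[k] TrivialLieModule k L k ≃ₗ⁅k, L⁆ V where
  __ := (TrivialLieModule.equiv k L k).lTensor V ≪≫ₗ TensorProduct.rid k V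
  map_lie' := fun {x v} => by
    change ((TrivialLieModule.equiv k L k).lTensor V ≪≫ₗ TensorProduct.rid k V) ⁅x, v⁆ =
      ⁅x, ((TrivialLieModule.equiv k L k).lTensor V ≪≫ₗ TensorProduct.rid k V) v⁆
    induction v with
    | zero => simp
    | add v w hv hw => rw [lie_add, map_add, map_add, lie_add, hv, hw]
    | tmul v t => simp [trivial_lie_zero]

variable (k L) in
/-- Derivations into the trivial module are the linear forms that vanish on `[L, L]`. -/
def h1TrivialEquiv : H1 k L (TrivialLieModule k L k) ≃ₗ[k] AbDual k L :=
  have h0 : LinearMap.range (LieDerivation.inner k L (TrivialLieModule k L k)) = ⊥ := by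
    rw [LinearMap.range_eq_bot]
    refine LinearMap.ext fun v => LieDerivation.ext fun x => ?_
    exact trivial_lie_zero L (TrivialLieModule k L k) x v
  Submodule.quotEquivOfEqBot _ h0 ≪≫ₗ
    LinearEquiv.ofLinearMap
      { toFun := fun D => Submodule.liftQ _
          ((TrivialLieModule.equiv k L k).toLinearMap ∘ₗ (D : L →ₗ[k] TrivialLieModule k L k)) (by
            rw [LieSubmodule.lieIdeal_oper_eq_linear_span', Submodule.span_le]
            rintro _ ⟨x, -, y, -, rfl⟩
            change D ⁅x, y⁆ = 0
            rw [LieDerivation.apply_lie_eq_sub, trivial_lie_zero, trivial_lie_zero, sub_zero])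
        map_add' := fun D D' => by
          refine Submodule.linearMap_qext _ ?_
          rfl
        map_smul' := fun t D => by
          refine Submodule.linearMap_qext _ ?_
          rfl }
      { toFun := fun φ =>
          { toLinearMap := (TrivialLieModule.equiv k L k).symm.toLinearMap ∘ₗ φ ∘ₗ
              Submodule.mkQ (⁅(⊤ : LieIdeal k L), (⊤ : LieIdeal k L)⁆).toSubmodule
            leibniz' := fun x y => by
              refine Eq.trans ?_ (sub_self _).symm
              change (TrivialLieModule.equiv k L k).symm (φ (Submodule.Quotient.mk ⁅x, y⁆)) = 0
              rw [(Submodule.Quotient.mk_eq_zero _).mpr, map_zero, map_zero]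
              exact LieSubmodule.lie_mem_lie (LieSubmodule.mem_top x) (LieSubmodule.mem_top y) }
        map_add' := fun φ ψ => rfl
        map_smul' := fun t φ => rfl }
      (by
        refine LinearMap.ext fun φ => ?_
        refine Submodule.linearMap_qext _ ?_
        rfl)
      (by
        refine LinearMap.ext fun D => ?_
        rfl)

universe v in
/-- `Ext¹_L(V, W) ≅ H¹(L, Hom_k(V, W))`, as vector spaces. -/
def ext1Equiv (k L : Type*) [Field k] [LieRing L] [LieAlgebra k L] (V W : Type v)
    [AddCommGroup V] [Module k V] [LieRingModule L V] [LieModule k L V]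
    [AddCommGroup W] [Module k W] [LieRingModule L W] [LieModule k L W] :
    Ext1 k L V W ≃ₗ[k] H1 k L (V →ₗ[k] W) :=
  (Ext1.equivH1 k L V W).linearEquiv k

end Cohomology

/-! ### Modules without invariants -/

section Invariants

/-- The space of invariants `V^L` is zero. -/
def NoInvariants (L V : Type*) [Zero V] [Bracket L V] : Prop :=
  ∀ v : V, (∀ x : L, ⁅x, v⁆ = 0) → v = 0

variable {k L : Type*} [Field k] [LieRing L] [LieAlgebra k L]
  {V : Type*} [AddCommGroup V] [Module k V] [LieRingModule L V] [LieModule k L V]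

/-- `(V ⊗ Q)^L = V^L ⊗ Q` for a vector space `Q`, in the case `V^L = 0`. -/
theorem NoInvariants.eq_zero_of_rTensor (hV : NoInvariants L V) {Q : Type*} [AddCommGroup Q]
    [Module k Q] (z : V ⊗[k] Q) (hz : ∀ x : L, (LieModule.toEnd k L V x).rTensor Q z = 0) :
    z = 0 := by
  classical
  let b := Module.Basis.ofVectorSpace k Q
  let φ := TensorProduct.equivFinsuppOfBasisRight (M := V) b
  have key : ∀ (x : L) (z : V ⊗[k] Q) i,
      φ ((LieModule.toEnd k L V x).rTensor Q z) i = ⁅x, φ z i⁆ := by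
    intro x z i
    induction z with
    | zero => simp
    | add z w hz hw => simp only [map_add, Finsupp.add_apply, hz, hw, lie_add]
    | tmul v q => simp [φ]
  apply φ.injective
  rw [map_zero]
  ext i
  exact hV _ fun x => by rw [← key, hz, map_zero, Finsupp.zero_apply]

/-- `(Q ⊗ V)^L = Q ⊗ V^L` for a vector space `Q`, in the case `V^L = 0`. -/
theorem NoInvariants.eq_zero_of_lTensor (hV : NoInvariants L V) {Q : Type*} [AddCommGroup Q]
    [Module k Q] (z : Q ⊗[k] V) (hz : ∀ x : L, (LieModule.toEnd k L V x).lTensor Q z = 0) :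
    z = 0 := by
  apply (TensorProduct.comm k Q V).injective
  rw [map_zero]
  refine hV.eq_zero_of_rTensor _ fun x => ?_
  rw [← map_zero (TensorProduct.comm k Q V), ← hz x]
  generalize z = w
  induction w with
  | zero => simp
  | add z w hz hw => simp only [map_add, hz, hw]
  | tmul q v => simp

end Invariants

/-! ### Vanishing of the cohomology of an outer tensor product -/

section Vanishing

variable {k L : Type*} [Field k] [LieRing L] [LieAlgebra k L]

/-- The linear map `e` lies in the centroid of `L`, that is, it commutes with all `ad x`. -/
def IsCentroid (e : L →ₗ[k] L) : Prop := ∀ x y : L, ⁅x, e y⁆ = e ⁅x, y⁆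

theorem IsCentroid.lie_right {e : L →ₗ[k] L} (he : IsCentroid e) (x y : L) :
    ⁅x, e y⁆ = e ⁅x, y⁆ := he x y

theorem IsCentroid.lie_left {e : L →ₗ[k] L} (he : IsCentroid e) (x y : L) :
    ⁅e x, y⁆ = e ⁅x, y⁆ := by
  rw [← lie_skew, he.lie_right, ← map_neg, lie_skew]

/-- `e x` acts on `V` as `x` does, for all `x`. -/
def ActsAsId (e : L →ₗ[k] L) (V : Type*) [Bracket L V] : Prop := ∀ (x : L) (v : V), ⁅e x, v⁆ = ⁅x, v⁆

/-- `e x` annihilates `V`, for all `x`. -/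
def ActsAsZero (e : L →ₗ[k] L) (V : Type*) [Zero V] [Bracket L V] : Prop :=
  ∀ (x : L) (v : V), ⁅e x, v⁆ = 0

variable {V W : Type*}
  [AddCommGroup V] [Module k V] [LieRingModule L V] [LieModule k L V]
  [AddCommGroup W] [Module k W] [LieRingModule L W] [LieModule k L W]

theorem lie_tensor (x : L) (z : V ⊗[k] W) :
    ⁅x, z⁆ = (LieModule.toEnd k L V x).rTensor W z + (LieModule.toEnd k L W x).lTensor V z := rfl

theorem lie_centroid_tensor {e : L →ₗ[k] L} (hV : ActsAsId e V) (hW : ActsAsZero e W) (x : L)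
    (z : V ⊗[k] W) : ⁅e x, z⁆ = (LieModule.toEnd k L V x).rTensor W z := by
  have h1 : LieModule.toEnd k L V (e x) = LieModule.toEnd k L V x := LinearMap.ext (hV x)
  have h2 : LieModule.toEnd k L W (e x) = 0 := LinearMap.ext (hW x)
  rw [lie_tensor, h1, h2, LinearMap.lTensor_zero, LinearMap.zero_apply, add_zero]

theorem lie_sub_centroid_tensor {e : L →ₗ[k] L} (hV : ActsAsId e V) (hW : ActsAsZero e W) (x : L)
    (z : V ⊗[k] W) : ⁅x - e x, z⁆ = (LieModule.toEnd k L W x).lTensor V z := by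
  rw [sub_lie, lie_centroid_tensor hV hW, lie_tensor, add_sub_cancel_left]

/-- If `V^L = 0`, then `(V ⊗ W)^L = 0` as soon as a centroid element separates `V` from `W`. -/
theorem NoInvariants.tensor {e : L →ₗ[k] L} (hV : ActsAsId e V) (hW : ActsAsZero e W)
    (h : NoInvariants L V) : NoInvariants L (V ⊗[k] W) := fun z hz =>
  h.eq_zero_of_rTensor z fun x => by rw [← lie_centroid_tensor hV hW, hz]

/-- If the vectors `δ x` of `V ⊗ W` satisfy `y δ(x) = x δ'(y)` with `x` acting on `V` and `y` on
`W`, and `W^L = 0`, then `δ(x) = x z` for a fixed `z`: contracting with the linear forms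
`λ ∘ y` on `W`, which span the dual of `W`, gives the coordinates of `z`. -/
theorem exists_rTensor_eq [FiniteDimensional k W] (hW : NoInvariants L W) (δ δ' : L → V ⊗[k] W)
    (h : ∀ x y, (LieModule.toEnd k L W y).lTensor V (δ x) =
      (LieModule.toEnd k L V x).rTensor W (δ' y)) :
    ∃ z, ∀ x, δ x = (LieModule.toEnd k L V x).rTensor W z := by
  let c : Module.Dual k W →ₗ[k] V ⊗[k] W →ₗ[k] V :=
    { toFun := fun l => (TensorProduct.rid k V).toLinearMap ∘ₗ l.lTensor V
      map_add' := fun l l' => by rw [LinearMap.lTensor_add, LinearMap.comp_add]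
      map_smul' := fun t l => by
        rw [LinearMap.lTensor_smul, LinearMap.comp_smul, RingHom.id_apply] }
  have hc : ∀ l v w, c l (v ⊗ₜ w) = l w • v := fun l v w => by simp [c]
  have hcV : ∀ l x z, c l ((LieModule.toEnd k L V x).rTensor W z) = ⁅x, c l z⁆ := by
    intro l x z
    induction z with
    | zero => simp
    | add z w hz hw => simp only [map_add, lie_add, hz, hw]
    | tmul v w => simp [hc]
  have hcW : ∀ l y z, c l ((LieModule.toEnd k L W y).lTensor V z) =
      c (l ∘ₗ LieModule.toEnd k L W y) z := by
    intro l x z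
    induction z with
    | zero => simp
    | add z w hz hw => simp only [map_add, hz, hw]
    | tmul v w => simp [hc]
  let N : Submodule k (Module.Dual k W) :=
    { carrier := {l | ∃ v : V, ∀ x, c l (δ x) = ⁅x, v⁆}
      add_mem' := by
        rintro l l' ⟨v, hv⟩ ⟨v', hv'⟩
        exact ⟨v + v', fun x => by rw [map_add, LinearMap.add_apply, hv, hv', lie_add]⟩
      zero_mem' := ⟨0, fun x => by rw [map_zero, LinearMap.zero_apply, lie_zero]⟩
      smul_mem' := by
        rintro t l ⟨v, hv⟩
        exact ⟨t • v, fun x => by rw [map_smul, LinearMap.smul_apply, hv, lie_smul]⟩ }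
  have hN : ∀ l y, l ∘ₗ LieModule.toEnd k L W y ∈ N := fun l y =>
    ⟨c l (δ' y), fun x => by rw [← hcW, h, hcV]⟩
  have hbot : N.dualCoannihilator = ⊥ := by
    rw [eq_bot_iff]
    intro w hw
    rw [Submodule.mem_dualCoannihilator] at hw
    refine hW w fun y => ?_
    rw [← Module.forall_dual_apply_eq_zero_iff k]
    exact fun l => hw _ (hN l y)
  have htop : ∀ l, l ∈ N := by
    intro l
    rw [← Subspace.dualCoannihilator_dualAnnihilator_eq (W := N), hbot]
    simp
  let b := Module.finBasis k W
  choose v hv using fun i => htop (b.coord i)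
  have hexp : ∀ z : V ⊗[k] W, z = ∑ i, c (b.coord i) z ⊗ₜ b i := by
    intro z
    induction z with
    | zero => simp
    | add z w hz hw =>
      simp only [map_add, TensorProduct.add_tmul, Finset.sum_add_distrib]
      rw [← hz, ← hw]
    | tmul v w =>
      simp only [hc, TensorProduct.smul_tmul, ← TensorProduct.tmul_sum]
      congr 1
      exact (b.sum_repr w).symm
  refine ⟨∑ i, v i ⊗ₜ b i, fun x => ?_⟩
  rw [hexp (δ x), map_sum]
  refine Finset.sum_congr rfl fun i _ => ?_
  rw [hv, LinearMap.rTensor_tmul, LieModule.toEnd_apply_apply]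

/-- If a centroid element `e` separates `V` from `W` and neither module has invariants, then
`H¹(L, V ⊗ W) = 0`. A derivation `D` vanishes on `e f L`, where `f = 1 - e`, because
`D ⁅f z, ⁅e x, e f y⁆⁆` is zero and equal to `z x D(e f y)`, with `x` acting on `V` and `z` on `W`.
Hence `y D(e x) = x D(f y)`, and `exists_rTensor_eq` applies. -/
theorem h1_tensor_subsingleton [FiniteDimensional k W] {e : L →ₗ[k] L} (he : IsCentroid e)
    (heV : ActsAsId e V) (heW : ActsAsZero e W) (hV : NoInvariants L V) (hW : NoInvariants L W) :
    Subsingleton (H1 k L (V ⊗[k] W)) := by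
  suffices H : ∀ D : LieDerivation k L (V ⊗[k] W), ∃ z, ∀ x, D x = ⁅x, z⁆ by
    refine subsingleton_of_forall_eq 0 fun a => ?_
    induction a using Submodule.Quotient.induction_on with
    | _ D =>
      obtain ⟨z, hz⟩ := H D
      rw [Submodule.Quotient.mk_eq_zero]
      exact ⟨z, LieDerivation.ext fun x => (hz x).symm⟩
  intro D
  have h1 := lie_centroid_tensor heV heW
  have h2 := lie_sub_centroid_tensor heV heW
  -- `e f L` annihilates `V ⊗ W`
  have h3 : ∀ (y : L) (z : V ⊗[k] W), ⁅e (y - e y), z⁆ = 0 := by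
    intro y z
    have : LieModule.toEnd k L V (y - e y) = 0 := by
      ext v
      rw [LieModule.toEnd_apply_apply, sub_lie, heV, sub_self, LinearMap.zero_apply]
    rw [h1, this, LinearMap.rTensor_zero, LinearMap.zero_apply]
  -- `D` vanishes on `e f L`
  have h4 : ∀ y, D (e (y - e y)) = 0 := by
    intro y
    refine hV.eq_zero_of_rTensor _ fun x => hW.eq_zero_of_lTensor _ fun z => ?_
    have a1 : D ⁅e x, e (y - e y)⁆ =
        (LieModule.toEnd k L V x).rTensor W (D (e (y - e y))) := by
      rw [LieDerivation.apply_lie_eq_sub, h1, h3, sub_zero]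
    have a2 : ⁅e x, e (y - e y)⁆ = e (e ⁅x, y⁆ - e (e ⁅x, y⁆)) := by
      rw [he.lie_left, he.lie_right, lie_sub, he.lie_right, map_sub, map_sub]
    have a3 : D ⁅z - e z, ⁅e x, e (y - e y)⁆⁆ =
        (LieModule.toEnd k L W z).lTensor V
          ((LieModule.toEnd k L V x).rTensor W (D (e (y - e y)))) := by
      rw [LieDerivation.apply_lie_eq_sub, a1, h2, a2, h3, sub_zero]
    have a4 : ⁅z - e z, ⁅e x, e (y - e y)⁆⁆ = ⁅e (z - e z), e (⁅x, y⁆ - e ⁅x, y⁆)⁆ := by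
      rw [a2]
      simp only [map_sub, sub_lie, lie_sub, he.lie_left, he.lie_right]
    rw [← a3, a4, LieDerivation.apply_lie_eq_sub, h3, h3, sub_zero]
  -- because `⁅e x, f y⁆` lies in `e f L`
  have h5 : ∀ x y, (LieModule.toEnd k L W y).lTensor V (D (e x)) =
      (LieModule.toEnd k L V x).rTensor W (D (y - e y)) := by
    intro x y
    have a1 := LieDerivation.apply_lie_eq_sub D (e x) (y - e y)
    have a2 : ⁅e x, y - e y⁆ = e (⁅x, y⁆ - e ⁅x, y⁆) := by
      rw [he.lie_left, lie_sub, he.lie_right]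
    rw [a2, h4, h1, h2] at a1
    exact (sub_eq_zero.mp a1.symm).symm
  obtain ⟨z, hz⟩ := exists_rTensor_eq hW (fun x => D (e x)) (fun y => D (y - e y)) h5
  refine ⟨z, fun x => ?_⟩
  have h6 : D (x - e x) = (LieModule.toEnd k L W x).lTensor V z := by
    rw [← sub_eq_zero]
    refine hV.eq_zero_of_rTensor _ fun y => ?_
    rw [map_sub, ← h5, hz, sub_eq_zero, ← LinearMap.comp_apply, ← LinearMap.comp_apply,
      LinearMap.lTensor_comp_rTensor, LinearMap.rTensor_comp_lTensor]
  have h7 : D x = D (e x) + D (x - e x) := by rw [← map_add, add_sub_cancel]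
  rw [h7, h6, hz, lie_tensor]

end Vanishing

/-! ### Homomorphisms between simple modules -/

section Schur

variable {k L : Type*} [Field k] [LieRing L] [LieAlgebra k L]
  {E F E' F' E₁ E₂ F₁ F₂ : Type*}
  [AddCommGroup E] [Module k E] [LieRingModule L E] [LieModule k L E]
  [AddCommGroup F] [Module k F] [LieRingModule L F] [LieModule k L F]
  [AddCommGroup E'] [Module k E'] [LieRingModule L E'] [LieModule k L E']
  [AddCommGroup F'] [Module k F'] [LieRingModule L F'] [LieModule k L F']
  [AddCommGroup E₁] [Module k E₁] [LieRingModule L E₁] [LieModule k L E₁]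
  [AddCommGroup E₂] [Module k E₂] [LieRingModule L E₂] [LieModule k L E₂]
  [AddCommGroup F₁] [Module k F₁] [LieRingModule L F₁] [LieModule k L F₁]
  [AddCommGroup F₂] [Module k F₂] [LieRingModule L F₂] [LieModule k L F₂]

omit [LieAlgebra k L] [LieModule k L E] [LieModule k L F] in
/-- Schur's lemma: a nonzero homomorphism between simple modules is an isomorphism. -/
theorem nonempty_equiv_of_ne_zero [LieModule.IsIrreducible k L E] [LieModule.IsIrreducible k L F]
    (f : E →ₗ⁅k, L⁆ F) (hf : f ≠ 0) : Nonempty (E ≃ₗ⁅k, L⁆ F) := by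
  have hker : f.ker = ⊥ := by
    refine (eq_bot_or_eq_top _).resolve_right fun h => hf ?_
    ext v
    exact LieModuleHom.mem_ker.mp (h ▸ LieSubmodule.mem_top v)
  have hrange : f.range = ⊤ := by
    refine (eq_bot_or_eq_top _).resolve_left fun h => hf ?_
    ext v
    exact (LieSubmodule.mem_bot _).mp (h ▸ (LieModuleHom.mem_range f _).mpr ⟨v, rfl⟩)
  exact ⟨{ LinearEquiv.ofBijective (f : E →ₗ[k] F)
      ⟨(LieModuleHom.ker_eq_bot f).mp hker, (LieModuleHom.range_eq_top f).mp hrange⟩ with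
    map_lie' := fun {x v} => LieModuleHom.map_lie f x v }⟩

/-- An invariant linear map is a homomorphism of modules. -/
def homOfInvariant (f : E →ₗ[k] F) (hf : ∀ x : L, ⁅x, f⁆ = 0) : E →ₗ⁅k, L⁆ F where
  __ := f
  map_lie' := fun {x v} => by
    have h := LinearMap.congr_fun (hf x) v
    rw [LieHom.lie_apply, LinearMap.zero_apply, sub_eq_zero] at h
    exact h.symm

theorem noInvariants_hom [LieModule.IsIrreducible k L E] [LieModule.IsIrreducible k L F]
    (h : ¬ Nonempty (E ≃ₗ⁅k, L⁆ F)) : NoInvariants L (E →ₗ[k] F) := by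
  intro f hf
  by_contra h0
  refine h (nonempty_equiv_of_ne_zero (homOfInvariant f hf) fun h1 => h0 ?_)
  exact LinearMap.ext fun v => LieModuleHom.congr_fun h1 v

/-- An endomorphism of a simple finite-dimensional module is a scalar. -/
theorem exists_eq_smul_of_invariant [IsAlgClosed k] [FiniteDimensional k E]
    [LieModule.IsIrreducible k L E] (f : E →ₗ[k] E) (hf : ∀ x : L, ⁅x, f⁆ = 0) :
    ∃ t : k, ∀ v, f v = t • v := by
  have : Nontrivial E := (LieSubmodule.nontrivial_iff k L E).mp inferInstance
  obtain ⟨t, ht⟩ := Module.End.exists_eigenvalue (K := k) f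
  obtain ⟨v, hv⟩ := ht.exists_hasEigenvector
  let g : E →ₗ⁅k, L⁆ E := homOfInvariant f hf - t • LieModuleHom.id
  have hg : ∀ v, g v = f v - t • v := fun _ => rfl
  have hker : g.ker = ⊤ := by
    refine (eq_bot_or_eq_top _).resolve_left fun h => hv.2 ?_
    refine (LieSubmodule.mem_bot (R := k) (L := L) v).mp (h ▸ LieModuleHom.mem_ker.mpr ?_)
    rw [hg, hv.apply_eq_smul, sub_self]
  refine ⟨t, fun v => sub_eq_zero.mp ?_⟩
  exact LieModuleHom.mem_ker.mp (hker ▸ LieSubmodule.mem_top v)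

/-- For isomorphic simple modules `E` and `F`, the trivial module is a direct summand of
`Hom(E, F)`, by means of the trace, and its complement has no invariants. -/
theorem exists_trivial_split_hom [IsAlgClosed k] [CharZero k] [FiniteDimensional k E]
    [LieModule.IsIrreducible k L E] (φ : E ≃ₗ⁅k, L⁆ F) :
    ∃ (i : TrivialLieModule k L k →ₗ⁅k, L⁆ (E →ₗ[k] F))
      (p : (E →ₗ[k] F) →ₗ⁅k, L⁆ TrivialLieModule k L k),
      (∀ a, p (i a) = a) ∧ NoInvariants L p.ker := by
  have : Nontrivial E := (LieSubmodule.nontrivial_iff k L E).mp inferInstance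
  have hn : (Module.finrank k E : k) ≠ 0 := Nat.cast_ne_zero.mpr Module.finrank_pos.ne'
  let φ' : E →ₗ[k] F := (φ : E →ₗ⁅k, L⁆ F)
  let ψ' : F →ₗ[k] E := (φ.symm : F →ₗ⁅k, L⁆ E)
  have hψφ : ψ' ∘ₗ φ' = LinearMap.id := LinearMap.ext φ.symm_apply_apply
  have hφψ : φ' ∘ₗ ψ' = LinearMap.id := LinearMap.ext φ.apply_symm_apply
  have hφ : ∀ (x : L) v, φ' ⁅x, v⁆ = ⁅x, φ' v⁆ := fun x v =>
    LieModuleHom.map_lie (φ : E →ₗ⁅k, L⁆ F) x v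
  have hψ : ∀ (x : L) v, ψ' ⁅x, v⁆ = ⁅x, ψ' v⁆ := fun x v =>
    LieModuleHom.map_lie (φ.symm : F →ₗ⁅k, L⁆ E) x v
  have hψlie : ∀ (x : L) (f : E →ₗ[k] F), ψ' ∘ₗ ⁅x, f⁆ = ⁅x, ψ' ∘ₗ f⁆ := fun x f => by
    ext v
    simp only [LinearMap.comp_apply, LieHom.lie_apply, map_sub, hψ]
  let i : TrivialLieModule k L k →ₗ⁅k, L⁆ (E →ₗ[k] F) :=
    { LinearMap.smulRight (TrivialLieModule.equiv k L k).toLinearMap φ' with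
      map_lie' := fun {x t} => by
        change TrivialLieModule.equiv k L k ⁅x, t⁆ • φ' =
          ⁅x, TrivialLieModule.equiv k L k t • φ'⁆
        have h0 : ⁅x, φ'⁆ = 0 := by
          ext v
          rw [LieHom.lie_apply, hφ, sub_self, LinearMap.zero_apply]
        rw [trivial_lie_zero, map_zero, zero_smul, lie_smul, h0, smul_zero] }
  let p₀ : (E →ₗ[k] F) →ₗ[k] k :=
    { toFun := fun f => (Module.finrank k E : k)⁻¹ * LinearMap.trace k E (ψ' ∘ₗ f)
      map_add' := fun f g => by rw [LinearMap.comp_add, map_add, mul_add]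
      map_smul' := fun t f => by
        rw [LinearMap.comp_smul, map_smul, smul_eq_mul, RingHom.id_apply, smul_eq_mul,
          mul_left_comm] }
  have hp₀ : ∀ f, p₀ f = (Module.finrank k E : k)⁻¹ * LinearMap.trace k E (ψ' ∘ₗ f) :=
    fun _ => rfl
  let p : (E →ₗ[k] F) →ₗ⁅k, L⁆ TrivialLieModule k L k :=
    { (TrivialLieModule.equiv k L k).symm.toLinearMap ∘ₗ p₀ with
      map_lie' := fun {x f} => by
        change (TrivialLieModule.equiv k L k).symm (p₀ ⁅x, f⁆) = 0
        have h0 : ⁅x, ψ' ∘ₗ f⁆ = LieModule.toEnd k L E x * (ψ' ∘ₗ f) -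
            (ψ' ∘ₗ f) * LieModule.toEnd k L E x := by
          ext v
          rfl
        rw [hp₀, hψlie, h0, map_sub, LinearMap.trace_mul_comm, sub_self, mul_zero, map_zero] }
  -- `i t = t φ` and `p f = tr(φ⁻¹ f) / dim E`
  refine ⟨i, p, fun t => ?_, ?_⟩
  · apply (TrivialLieModule.equiv k L k).injective
    change p₀ (TrivialLieModule.equiv k L k t • φ') = TrivialLieModule.equiv k L k t
    rw [map_smul, hp₀, hψφ, LinearMap.trace_id, inv_mul_cancel₀ hn, smul_eq_mul, mul_one]
  · rintro ⟨f, hf⟩ hinv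
    have hinv' : ∀ x : L, ⁅x, f⁆ = 0 := fun x => congrArg Subtype.val (hinv x)
    obtain ⟨t, ht⟩ := exists_eq_smul_of_invariant (L := L) (ψ' ∘ₗ f) fun x => by
      rw [← hψlie, hinv', LinearMap.comp_zero]
    have h1 : ψ' ∘ₗ f = t • LinearMap.id := LinearMap.ext ht
    have h2 : p₀ f = 0 := LieModuleHom.mem_ker.mp hf
    rw [hp₀, h1, map_smul, LinearMap.trace_id, smul_eq_mul, mul_left_comm,
      inv_mul_cancel₀ hn, mul_one] at h2
    refine Subtype.ext ?_
    change f = 0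
    rw [← LinearMap.id_comp f, ← hφψ, LinearMap.comp_assoc, h1, h2, zero_smul, LinearMap.comp_zero]

/-- `Hom(E, F) ≅ Hom(E', F')` for isomorphic modules. -/
def homCongr (e : E ≃ₗ⁅k, L⁆ E') (f : F ≃ₗ⁅k, L⁆ F') :
    (E →ₗ[k] F) ≃ₗ⁅k, L⁆ (E' →ₗ[k] F') where
  __ := LinearEquiv.arrowCongr e.toLinearEquiv f.toLinearEquiv
  map_lie' := fun {x h} => by
    ext v
    change (f : F →ₗ⁅k, L⁆ F') (⁅x, h (e.symm v)⁆ - h ⁅x, e.symm v⁆) =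
      ⁅x, f (h (e.symm v))⁆ - f (h ((e.symm : E' →ₗ⁅k, L⁆ E) ⁅x, v⁆))
    rw [map_sub, LieModuleHom.map_lie, LieModuleHom.map_lie]
    rfl

/-- `Hom(E₁, F₁) ⊗ Hom(E₂, F₂) ≅ Hom(E₁ ⊗ E₂, F₁ ⊗ F₂)`. -/
def homTensorHom [FiniteDimensional k E₁] [FiniteDimensional k E₂] :
    (E₁ →ₗ[k] F₁) ⊗[k] (E₂ →ₗ[k] F₂) ≃ₗ⁅k, L⁆ (E₁ ⊗[k] E₂ →ₗ[k] F₁ ⊗[k] F₂) where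
  __ := homTensorHomEquiv k E₁ E₂ F₁ F₂
  map_lie' := fun {x h} => by
    change homTensorHomEquiv k E₁ E₂ F₁ F₂ ⁅x, h⁆ = ⁅x, homTensorHomEquiv k E₁ E₂ F₁ F₂ h⁆
    induction h with
    | zero => simp
    | add h h' a b => rw [lie_add, map_add, map_add, lie_add, a, b]
    | tmul f g =>
      ext v w
      simp [TensorProduct.sub_tmul, TensorProduct.tmul_sub]
      abel

/-- A tensor factor of a simple module is simple. -/
theorem isIrreducible_left_of_tensor [LieModule.IsIrreducible k L (E ⊗[k] F)] :
    LieModule.IsIrreducible k L E := by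
  have hnt : Nontrivial (E ⊗[k] F) := (LieSubmodule.nontrivial_iff k L _).mp inferInstance
  have hE : Nontrivial E := by
    by_contra h
    rw [not_nontrivial_iff_subsingleton] at h
    exact not_subsingleton (E ⊗[k] F) inferInstance
  have hF : Nontrivial F := by
    by_contra h
    rw [not_nontrivial_iff_subsingleton] at h
    exact not_subsingleton (E ⊗[k] F) inferInstance
  refine LieModule.IsIrreducible.mk fun N hN => ?_
  obtain ⟨w, hw⟩ := exists_ne (0 : F)
  obtain ⟨l, hl⟩ : ∃ l : Module.Dual k F, l w = 1 := by
    obtain ⟨l, hl⟩ := not_forall.mp (mt (Module.forall_dual_apply_eq_zero_iff k w).mp hw)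
    exact ⟨(l w)⁻¹ • l, by rw [LinearMap.smul_apply, smul_eq_mul, inv_mul_cancel₀ hl]⟩
  let c : E ⊗[k] F →ₗ[k] E := (TensorProduct.rid k E).toLinearMap ∘ₗ l.lTensor E
  have hc : ∀ v w, c (v ⊗ₜ w) = l w • v := fun v w => by simp [c]
  let T := (TensorProduct.LieModule.map N.incl (LieModuleHom.id : F →ₗ⁅k, L⁆ F)).range
  -- `N ⊗ F` is all of `E ⊗ F`, and contraction with `l` maps it back to `N`
  have hT : T = ⊤ := by
    refine (eq_bot_or_eq_top T).resolve_left fun h => hN ?_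
    rw [LieSubmodule.eq_bot_iff]
    intro v hv
    have h1 : v ⊗ₜ[k] w = 0 := (LieSubmodule.mem_bot (R := k) (L := L) _).mp
      (h ▸ (LieModuleHom.mem_range _ _).mpr ⟨⟨v, hv⟩ ⊗ₜ w, rfl⟩)
    rw [← one_smul k v, ← hl, ← hc, h1, map_zero]
  rw [eq_top_iff]
  intro v _
  have h2 : v ⊗ₜ[k] w ∈ T := hT ▸ LieSubmodule.mem_top _
  obtain ⟨z, hz⟩ := (LieModuleHom.mem_range _ _).mp h2
  have h3 : ∀ z, c (TensorProduct.LieModule.map N.incl (LieModuleHom.id : F →ₗ⁅k, L⁆ F) z) ∈ N := by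
    intro z
    induction z with
    | zero => rw [map_zero, map_zero]; exact N.zero_mem
    | add a b ha hb => rw [map_add, map_add]; exact N.add_mem ha hb
    | tmul a b =>
      rw [TensorProduct.LieModule.map_tmul, hc]
      exact N.smul_mem _ a.2
  have h4 := h3 z
  rwa [hz, hc, hl, one_smul] at h4

/-- `E ⊗ F ≅ F ⊗ E`. -/
def tensorComm : E ⊗[k] F ≃ₗ⁅k, L⁆ F ⊗[k] E where
  __ := TensorProduct.comm k E F
  map_lie' := fun {x z} => by
    change TensorProduct.comm k E F ⁅x, z⁆ = ⁅x, TensorProduct.comm k E F z⁆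
    induction z with
    | zero => simp
    | add a b ha hb => rw [lie_add, map_add, map_add, lie_add, ha, hb]
    | tmul a b => simp [add_comm]

omit [LieAlgebra k L] [LieModule k L E] [LieModule k L F] in
theorem isIrreducible_of_equiv [h : LieModule.IsIrreducible k L E] (e : E ≃ₗ⁅k, L⁆ F) :
    LieModule.IsIrreducible k L F := by
  have : Nontrivial E := (LieSubmodule.nontrivial_iff k L E).mp inferInstance
  have : Nontrivial F := e.symm.toEquiv.nontrivial
  refine LieModule.IsIrreducible.mk fun N hN => ?_
  have hmem : ∀ v, v ∈ N.comap (e : E →ₗ⁅k, L⁆ F) ↔ e v ∈ N := fun v => LieSubmodule.mem_comap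
  rcases eq_bot_or_eq_top (N.comap (e : E →ₗ⁅k, L⁆ F)) with h0 | h0
  · exfalso
    refine hN ((LieSubmodule.eq_bot_iff N).mpr fun w hw => ?_)
    have h1 : e.symm w ∈ N.comap (e : E →ₗ⁅k, L⁆ F) := by
      rw [hmem, LieModuleEquiv.apply_symm_apply]
      exact hw
    rw [h0, LieSubmodule.mem_bot] at h1
    rw [← e.apply_symm_apply w, h1]
    exact map_zero (e : E →ₗ⁅k, L⁆ F)
  · rw [eq_top_iff]
    intro w _
    have h1 : e.symm w ∈ N.comap (e : E →ₗ⁅k, L⁆ F) := h0 ▸ LieSubmodule.mem_top _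
    rwa [hmem, LieModuleEquiv.apply_symm_apply] at h1

theorem isIrreducible_right_of_tensor [LieModule.IsIrreducible k L (E ⊗[k] F)] :
    LieModule.IsIrreducible k L F :=
  have := isIrreducible_of_equiv (tensorComm (k := k) (L := L) (E := E) (F := F))
  isIrreducible_left_of_tensor (k := k) (L := L) (E := F) (F := E)

theorem ActsAsId.hom {e : L →ₗ[k] L} (hE : ActsAsId e E) (hF : ActsAsId e F) :
    ActsAsId e (E →ₗ[k] F) := by
  intro x f
  ext v
  rw [LieHom.lie_apply, LieHom.lie_apply, hE, hF]

theorem ActsAsZero.hom {e : L →ₗ[k] L} (hE : ActsAsZero e E) (hF : ActsAsZero e F) :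
    ActsAsZero e (E →ₗ[k] F) := by
  intro x f
  ext v
  rw [LieHom.lie_apply, hE, hF, map_zero, sub_zero, LinearMap.zero_apply]

omit [LieModule k L E] in
theorem ActsAsId.submodule {e : L →ₗ[k] L} (hE : ActsAsId e E) (N : LieSubmodule k L E) :
    ActsAsId e N := fun x v => Subtype.ext (hE x v)

omit [LieModule k L E] in
theorem ActsAsZero.submodule {e : L →ₗ[k] L} (hE : ActsAsZero e E) (N : LieSubmodule k L E) :
    ActsAsZero e N := fun x v => Subtype.ext (hE x v)

/-- If `E ≅ E₁ ⊗ E₂` and `E ≅ F₁ ⊗ F₂`, where a centroid element `e` separates `E₁`, `F₁` from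
`E₂`, `F₂`, then the simple modules `E₁` and `F₁` are isomorphic, because the identity of `E` is
invariant under `e L`. -/
theorem nonempty_equiv_of_tensor [FiniteDimensional k E₁] [FiniteDimensional k E₂]
    [LieModule.IsIrreducible k L E₁] [LieModule.IsIrreducible k L F₁] [Nontrivial E]
    (e : L →ₗ[k] L) (he₁ : ActsAsId e E₁) (he₂ : ActsAsZero e E₂)
    (hf₁ : ActsAsId e F₁) (hf₂ : ActsAsZero e F₂)
    (α : E ≃ₗ⁅k, L⁆ E₁ ⊗[k] E₂) (β : E ≃ₗ⁅k, L⁆ F₁ ⊗[k] F₂) : Nonempty (E₁ ≃ₗ⁅k, L⁆ F₁) := by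
  by_contra h
  have h0 : NoInvariants L ((E₁ →ₗ[k] F₁) ⊗[k] (E₂ →ₗ[k] F₂)) :=
    (noInvariants_hom h).tensor (he₁.hom hf₁) (he₂.hom hf₂)
  let Φ := (homCongr α β).trans (homTensorHom (k := k) (L := L)).symm
  have h1 : Φ (LinearMap.id : E →ₗ[k] E) = 0 := h0 _ fun x => by
    have h2 : ⁅x, (LinearMap.id : E →ₗ[k] E)⁆ = 0 := by
      ext v
      rw [LieHom.lie_apply, LinearMap.id_apply, LinearMap.id_apply, sub_self, LinearMap.zero_apply]
    rw [← LieModuleEquiv.coe_coe, ← LieModuleHom.map_lie, h2, map_zero]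
  have h2 : (LinearMap.id : E →ₗ[k] E) = 0 :=
    Φ.injective (h1.trans (map_zero Φ.toLinearEquiv).symm)
  obtain ⟨v, hv⟩ := exists_ne (0 : E)
  exact hv (LinearMap.congr_fun h2 v)

end Schur

/-! ### Splitting a factor off a tensor product -/

section Split

theorem ext_tprod {k ι : Type*} [Field k] (V : ι → Type*) [∀ i, AddCommGroup (V i)]
    [∀ i, Module k (V i)] {N : Type*} [AddCommGroup N] [Module k N]
    (f g : (⨂[k] i, V i) →ₗ[k] N)
    (h : ∀ w, f (PiTensorProduct.tprod k w) = g (PiTensorProduct.tprod k w)) (z) : f z = g z :=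
  LinearMap.congr_fun (PiTensorProduct.ext (MultilinearMap.ext h)) z

variable {k L : Type*} [Field k] [LieRing L] [LieAlgebra k L]
  {ι : Type*} [Fintype ι] [DecidableEq ι]

section

variable (V : ι → Type*) [∀ i, AddCommGroup (V i)] [∀ i, Module k (V i)]

/-- The linear isomorphism `⨂ V i ≅ V j ⊗ ⨂_{i ≠ j} V i`. -/
def piTensorSplitLinear (j : ι) :
    (⨂[k] i, V i) ≃ₗ[k] V j ⊗[k] (⨂[k] i : {i // i ≠ j}, V i) :=
  (PiTensorProduct.equivPiTensorComplSingletonTensor k V j).trans (TensorProduct.comm k _ _)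

omit [Fintype ι] in
theorem piTensorSplitLinear_tprod (j : ι) (w : ∀ i, V i) :
    piTensorSplitLinear (k := k) V j (PiTensorProduct.tprod k w) =
      w j ⊗ₜ PiTensorProduct.tprod k fun i : {i // i ≠ j} => w i :=
  congrArg (TensorProduct.comm k _ _)
    (PiTensorProduct.equivPiTensorComplSingletonTensor_tprod k V j w)

variable [∀ i, LieRingModule L (V i)] [∀ i, LieModule k L (V i)]

theorem lie_tprod (x : L) (w : ∀ i, V i) :
    ⁅x, PiTensorProduct.tprod k w⁆ =
      ∑ i, PiTensorProduct.tprod k (Function.update w i ⁅x, w i⁆) := tensorAction_tprod V x w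

/-- The isomorphism of modules `⨂ V i ≅ V j ⊗ ⨂_{i ≠ j} V i`. -/
def piTensorSplit (j : ι) : (⨂[k] i, V i) ≃ₗ⁅k, L⁆ V j ⊗[k] (⨂[k] i : {i // i ≠ j}, V i) where
  __ := piTensorSplitLinear V j
  map_lie' := fun {x z} => by
    refine ext_tprod (k := k) V
      ((piTensorSplitLinear V j).toLinearMap ∘ₗ LieModule.toEnd k L _ x)
      (LieModule.toEnd k L _ x ∘ₗ (piTensorSplitLinear V j).toLinearMap) (fun w => ?_) z
    change piTensorSplitLinear V j ⁅x, PiTensorProduct.tprod k w⁆ =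
      ⁅x, piTensorSplitLinear V j (PiTensorProduct.tprod k w)⁆
    rw [lie_tprod, map_sum, piTensorSplitLinear_tprod, TensorProduct.LieModule.lie_tmul_right,
      lie_tprod, TensorProduct.tmul_sum, Fintype.sum_eq_add_sum_subtype_ne _ j]
    congr 1
    · rw [piTensorSplitLinear_tprod, Function.update_self]
      congr 2
      funext i
      rw [Function.update_of_ne i.2]
    · refine Finset.sum_congr rfl fun i _ => ?_
      rw [piTensorSplitLinear_tprod, Function.update_of_ne i.2.symm]
      congr 2
      funext l
      by_cases h : l = i
      · subst h
        rw [Function.update_self, Function.update_self]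
      · rw [Function.update_of_ne h, Function.update_of_ne fun h' => h (Subtype.ext h')]

variable {V}

theorem ActsAsZero.piTensor {e : L →ₗ[k] L} (h : ∀ i, ActsAsZero e (V i)) :
    ActsAsZero e (⨂[k] i, V i) := by
  intro x z
  refine ext_tprod (k := k) V (LieModule.toEnd k L _ (e x)) 0 (fun w => ?_) z
  change ⁅e x, PiTensorProduct.tprod k w⁆ = 0
  rw [lie_tprod]
  refine Finset.sum_eq_zero fun i _ => ?_
  rw [h i x]
  exact MultilinearMap.map_update_zero _ _ _

/-- Isomorphic factors give isomorphic tensor products. -/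
def piTensorCongr {W : ι → Type*} [∀ i, AddCommGroup (W i)] [∀ i, Module k (W i)]
    [∀ i, LieRingModule L (W i)] [∀ i, LieModule k L (W i)] (e : ∀ i, V i ≃ₗ⁅k, L⁆ W i) :
    (⨂[k] i, V i) ≃ₗ⁅k, L⁆ (⨂[k] i, W i) where
  __ := PiTensorProduct.congr fun i => (e i).toLinearEquiv
  map_lie' := fun {x z} => by
    let φ := PiTensorProduct.congr (R := k) fun i => (e i).toLinearEquiv
    refine ext_tprod (k := k) V (φ.toLinearMap ∘ₗ LieModule.toEnd k L _ x)
      (LieModule.toEnd k L _ x ∘ₗ φ.toLinearMap) (fun w => ?_) z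
    change φ ⁅x, PiTensorProduct.tprod k w⁆ = ⁅x, φ (PiTensorProduct.tprod k w)⁆
    have hφ : ∀ w, φ (PiTensorProduct.tprod k w) = PiTensorProduct.tprod k fun i => e i (w i) :=
      fun w => PiTensorProduct.congr_tprod _ w
    rw [lie_tprod, map_sum, hφ, lie_tprod]
    refine Finset.sum_congr rfl fun i _ => ?_
    rw [hφ]
    congr 1
    funext l
    by_cases h : l = i
    · subst h
      rw [Function.update_self, Function.update_self]
      exact LieModuleHom.map_lie (e l : V l →ₗ⁅k, L⁆ W l) x (w l)
    · rw [Function.update_of_ne h, Function.update_of_ne h]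

variable (k L V) in
/-- The homomorphisms between empty tensor products form the trivial module. -/
def homEmptyEquiv [IsEmpty ι] (W : ι → Type*) [∀ i, AddCommGroup (W i)] [∀ i, Module k (W i)]
    [∀ i, LieRingModule L (W i)] [∀ i, LieModule k L (W i)] :
    ((⨂[k] i, V i) →ₗ[k] (⨂[k] i, W i)) ≃ₗ⁅k, L⁆ TrivialLieModule k L k where
  __ := (LinearEquiv.arrowCongr (PiTensorProduct.isEmptyEquiv ι) (PiTensorProduct.isEmptyEquiv ι)
    ≪≫ₗ LinearMap.ringLmapEquivSelf k k k) ≪≫ₗ (TrivialLieModule.equiv k L k).symm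
  map_lie' := fun {x f} => by
    have hV : ∀ z : ⨂[k] i, V i, ⁅x, z⁆ = 0 := fun z =>
      ActsAsZero.piTensor (e := LinearMap.id) (fun i => isEmptyElim i) x z
    have hW : ∀ z : ⨂[k] i, W i, ⁅x, z⁆ = 0 := fun z =>
      ActsAsZero.piTensor (e := LinearMap.id) (fun i => isEmptyElim i) x z
    have h : ⁅x, f⁆ = 0 := by
      refine LinearMap.ext fun z => ?_
      rw [LieHom.lie_apply, hV, hW, map_zero, sub_zero, LinearMap.zero_apply]
    rw [h, trivial_lie_zero]
    exact map_zero _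

end

/-- The product of a family of vector spaces, with the factor of index `j` split off. -/
def piSplitAtLinear (j : ι) (P : ι → Type*) [∀ i, AddCommGroup (P i)] [∀ i, Module k (P i)] :
    (∀ i, P i) ≃ₗ[k] P j × ∀ i : {i // i ≠ j}, P i where
  __ := Equiv.piSplitAt j P
  map_add' _ _ := rfl
  map_smul' _ _ := rfl

end Split

/-! ### Extensions between tensor products -/

section Kuenneth

variable {k L : Type*} [Field k] [LieRing L] [LieAlgebra k L]

theorem NoInvariants.of_equiv {V W : Type*}
    [AddCommGroup V] [Module k V] [LieRingModule L V] [LieModule k L V]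
    [AddCommGroup W] [Module k W] [LieRingModule L W] [LieModule k L W]
    (e : V ≃ₗ⁅k, L⁆ W) (hW : NoInvariants L W) : NoInvariants L V := by
  intro v hv
  refine e.injective ((hW _ fun x => ?_).trans (map_zero e.toLinearEquiv).symm)
  rw [← LieModuleEquiv.coe_coe, ← LieModuleHom.map_lie, hv, map_zero]

/-- For each index `j`, some element of the centroid acts as the identity on `E j` and `F j`, and
as zero on the other modules of the two families. -/
def Separated {ι : Type*} (k L : Type*) [Field k] [LieRing L] [LieAlgebra k L] (E F : ι → Type*)
    [∀ i, AddCommGroup (E i)] [∀ i, LieRingModule L (E i)]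
    [∀ i, AddCommGroup (F i)] [∀ i, LieRingModule L (F i)] : Prop :=
  ∀ j, ∃ e : L →ₗ[k] L, IsCentroid e ∧ ActsAsId e (E j) ∧ ActsAsId e (F j) ∧
    ∀ i, i ≠ j → ActsAsZero e (E i) ∧ ActsAsZero e (F i)

theorem Separated.comp {ι κ : Type*} {E F : ι → Type*}
    [∀ i, AddCommGroup (E i)] [∀ i, LieRingModule L (E i)]
    [∀ i, AddCommGroup (F i)] [∀ i, LieRingModule L (F i)] (h : Separated k L E F)
    (f : κ → ι) (hf : Function.Injective f) :
    Separated k L (fun i => E (f i)) (fun i => F (f i)) := by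
  intro j
  obtain ⟨e, he, hE, hF, h0⟩ := h (f j)
  exact ⟨e, he, hE, hF, fun i hi => h0 _ fun h => hi (hf h)⟩

variable {ι : Type} [Fintype ι] [DecidableEq ι] {E F : ι → Type*}
  [∀ i, AddCommGroup (E i)] [∀ i, Module k (E i)]
  [∀ i, LieRingModule L (E i)] [∀ i, LieModule k L (E i)]
  [∀ i, AddCommGroup (F i)] [∀ i, Module k (F i)]
  [∀ i, LieRingModule L (F i)] [∀ i, LieModule k L (F i)]
  [∀ i, FiniteDimensional k (E i)] [∀ i, FiniteDimensional k (F i)]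

variable (k L E F) in
/-- `Hom(⨂ E i, ⨂ F i) ≅ Hom(E j, F j) ⊗ Hom(⨂_{i ≠ j} E i, ⨂_{i ≠ j} F i)`. -/
def homPiTensorSplit (j : ι) :
    ((⨂[k] i, E i) →ₗ[k] (⨂[k] i, F i)) ≃ₗ⁅k, L⁆
      (E j →ₗ[k] F j) ⊗[k] ((⨂[k] i : {i // i ≠ j}, E i) →ₗ[k] ⨂[k] i : {i // i ≠ j}, F i) :=
  (homCongr (piTensorSplit E j) (piTensorSplit F j)).trans homTensorHom.symm

omit [∀ i, FiniteDimensional k (F i)] in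
theorem noInvariants_hom_piTensor (hsep : Separated k L E F) (j : ι)
    [LieModule.IsIrreducible k L (E j)] [LieModule.IsIrreducible k L (F j)]
    (h : ¬ Nonempty (E j ≃ₗ⁅k, L⁆ F j)) :
    NoInvariants L ((⨂[k] i, E i) →ₗ[k] (⨂[k] i, F i)) := by
  obtain ⟨e, -, hE, hF, h0⟩ := hsep j
  refine NoInvariants.of_equiv (homPiTensorSplit k L E F j) ?_
  exact (noInvariants_hom h).tensor (hE.hom hF)
    ((ActsAsZero.piTensor fun i : {i // i ≠ j} => (h0 i i.2).1).hom
      (ActsAsZero.piTensor fun i : {i // i ≠ j} => (h0 i i.2).2))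

/-- There are no extensions between tensor products that differ in two factors. -/
theorem h1_hom_piTensor_subsingleton (hsep : Separated k L E F) (j j' : ι) (hj : j' ≠ j)
    [∀ i, LieModule.IsIrreducible k L (E i)] [∀ i, LieModule.IsIrreducible k L (F i)]
    (h : ¬ Nonempty (E j ≃ₗ⁅k, L⁆ F j)) (h' : ¬ Nonempty (E j' ≃ₗ⁅k, L⁆ F j')) :
    Subsingleton (H1 k L ((⨂[k] i, E i) →ₗ[k] (⨂[k] i, F i))) := by
  obtain ⟨e, he, hE, hF, h0⟩ := hsep j
  refine (H1.congr (homPiTensorSplit k L E F j)).toEquiv.subsingleton_congr.mpr ?_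
  refine h1_tensor_subsingleton he (hE.hom hF)
    ((ActsAsZero.piTensor fun i : {i // i ≠ j} => (h0 i i.2).1).hom
      (ActsAsZero.piTensor fun i : {i // i ≠ j} => (h0 i i.2).2)) (noInvariants_hom h) ?_
  exact noInvariants_hom_piTensor (hsep.comp Subtype.val Subtype.val_injective) ⟨j', hj⟩ h'

variable [IsAlgClosed k] [CharZero k]

omit [∀ i, FiniteDimensional k (F i)] in
/-- If two simple tensor products have isomorphic factors, then the homomorphisms between the
products of the factors of index `i ≠ j` are the sum of the trivial module and a module without
invariants. -/
theorem exists_trivial_split_hom_piTensor (j : ι) [LieModule.IsIrreducible k L (⨂[k] i, E i)]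
    (φ : ∀ i, i ≠ j → Nonempty (E i ≃ₗ⁅k, L⁆ F i)) :
    ∃ (i : TrivialLieModule k L k →ₗ⁅k, L⁆
        ((⨂[k] i : {i // i ≠ j}, E i) →ₗ[k] ⨂[k] i : {i // i ≠ j}, F i))
      (p : ((⨂[k] i : {i // i ≠ j}, E i) →ₗ[k] ⨂[k] i : {i // i ≠ j}, F i) →ₗ⁅k, L⁆
        TrivialLieModule k L k),
      (∀ a, p (i a) = a) ∧ NoInvariants L p.ker := by
  have := isIrreducible_of_equiv (piTensorSplit (k := k) (L := L) E j)
  have := isIrreducible_right_of_tensor (k := k) (L := L) (E := E j)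
    (F := ⨂[k] i : {i // i ≠ j}, E i)
  exact exists_trivial_split_hom (piTensorCongr fun i : {i // i ≠ j} => (φ i i.2).some)

/-- Extensions between simple tensor products that differ in exactly one factor. -/
theorem nonempty_h1_hom_piTensor_equiv (hsep : Separated k L E F) (j : ι)
    [LieModule.IsIrreducible k L (⨂[k] i, E i)]
    [∀ i, LieModule.IsIrreducible k L (E i)] [∀ i, LieModule.IsIrreducible k L (F i)]
    (h : ¬ Nonempty (E j ≃ₗ⁅k, L⁆ F j)) (φ : ∀ i, i ≠ j → Nonempty (E i ≃ₗ⁅k, L⁆ F i)) :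
    Nonempty (H1 k L ((⨂[k] i, E i) →ₗ[k] (⨂[k] i, F i)) ≃ₗ[k] H1 k L (E j →ₗ[k] F j)) := by
  obtain ⟨e, he, hE, hF, h0⟩ := hsep j
  obtain ⟨i, p, hip, hp⟩ := exists_trivial_split_hom_piTensor (k := k) (L := L) j φ
  have h1 := h1_tensor_subsingleton he (hE.hom hF)
    (((ActsAsZero.piTensor fun i : {i // i ≠ j} => (h0 i i.2).1).hom
      (ActsAsZero.piTensor fun i : {i // i ≠ j} => (h0 i i.2).2)).submodule p.ker)
    (noInvariants_hom h) hp
  let : Unique (H1 k L ((E j →ₗ[k] F j) ⊗[k] p.ker)) := uniqueOfSubsingleton 0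
  exact ⟨H1.congr (homPiTensorSplit k L E F j) ≪≫ₗ
    ((Biproduct.ofSplit i p hip).lTensor (E j →ₗ[k] F j)).h1Equiv ≪≫ₗ
    LinearEquiv.prodUnique ≪≫ₗ H1.congr (tensorTrivial k L (E j →ₗ[k] F j))⟩

end Kuenneth

/-! ### Extensions between tensor products with isomorphic factors -/

section IsomorphicFactors

variable {k L : Type*} [Field k] [LieRing L] [LieAlgebra k L]

/-- Extensions between simple tensor products with isomorphic factors: if
`Hom(E i, F i) = k₀ ⊕ ker (p i)`, then `H¹(L, Hom(⨂ E i, ⨂ F i))` is the direct sum of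
`H¹(L, k₀) = (L/L')*` and of the spaces `H¹(L, ker (p i))`. -/
theorem nonempty_h1_hom_piTensor_equiv_prod [IsAlgClosed k] [CharZero k] (n : ℕ) :
    ∀ {ι : Type} [Fintype ι] [DecidableEq ι] {E F : ι → Type*}
      [∀ i, AddCommGroup (E i)] [∀ i, Module k (E i)]
      [∀ i, LieRingModule L (E i)] [∀ i, LieModule k L (E i)]
      [∀ i, AddCommGroup (F i)] [∀ i, Module k (F i)]
      [∀ i, LieRingModule L (F i)] [∀ i, LieModule k L (F i)]
      [∀ i, FiniteDimensional k (E i)] [∀ i, FiniteDimensional k (F i)]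
      [LieModule.IsIrreducible k L (⨂[k] i, E i)]
      (_ : Fintype.card ι = n) (_ : Separated k L E F) (_ : ∀ i, Nonempty (E i ≃ₗ⁅k, L⁆ F i))
      (s : ∀ i, TrivialLieModule k L k →ₗ⁅k, L⁆ (E i →ₗ[k] F i))
      (p : ∀ i, (E i →ₗ[k] F i) →ₗ⁅k, L⁆ TrivialLieModule k L k)
      (_ : ∀ i a, p i (s i a) = a) (_ : ∀ i, NoInvariants L (p i).ker),
      Nonempty (H1 k L ((⨂[k] i, E i) →ₗ[k] (⨂[k] i, F i)) ≃ₗ[k]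
        AbDual k L × ∀ i, H1 k L (p i).ker) := by
  induction n with
  | zero =>
    intro ι _ _ E F _ _ _ _ _ _ _ _ _ _ _ hn hsep φ s p hsp hp
    have := Fintype.card_eq_zero_iff.mp hn
    let : Unique (∀ i, H1 k L (p i).ker) := uniqueOfSubsingleton 0
    exact ⟨H1.congr (homEmptyEquiv k L E F) ≪≫ₗ h1TrivialEquiv k L ≪≫ₗ
      LinearEquiv.prodUnique.symm⟩
  | succ n ih =>
    intro ι _ _ E F _ _ _ _ _ _ _ _ _ _ _ hn hsep φ s p hsp hp
    obtain ⟨j⟩ : Nonempty ι := Fintype.card_pos_iff.mp (by omega)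
    have := isIrreducible_of_equiv (piTensorSplit (k := k) (L := L) E j)
    have := isIrreducible_right_of_tensor (k := k) (L := L) (E := E j)
      (F := ⨂[k] i : {i // i ≠ j}, E i)
    obtain ⟨e, he, hE, hF, h0⟩ := hsep j
    obtain ⟨i, q, hiq, hq⟩ :=
      exists_trivial_split_hom_piTensor (k := k) (L := L) j fun i _ => φ i
    -- the summand of `Hom(⨂ E i, ⨂ F i)` in which neither factor has invariants
    have h1 := h1_tensor_subsingleton he ((hE.hom hF).submodule (p j).ker)
      (((ActsAsZero.piTensor fun i : {i // i ≠ j} => (h0 i i.2).1).hom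
        (ActsAsZero.piTensor fun i : {i // i ≠ j} => (h0 i i.2).2)).submodule q.ker) (hp j) hq
    let : Unique (H1 k L ((p j).ker ⊗[k] q.ker)) := uniqueOfSubsingleton 0
    have hcard : Fintype.card {i // i ≠ j} = n := by
      rw [Fintype.card_subtype_compl, hn, Fintype.card_subtype_eq, Nat.add_sub_cancel]
    obtain ⟨α⟩ := ih hcard (hsep.comp Subtype.val Subtype.val_injective) (fun i => φ i)
      (fun i => s i) (fun i => p i) (fun i => hsp i) (fun i => hp i)
    let β := ((Biproduct.ofSplit (s j) (p j) (hsp j)).rTensor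
      ((⨂[k] i : {i // i ≠ j}, E i) →ₗ[k] (⨂[k] i : {i // i ≠ j}, F i))).h1Equiv
    let γ := ((Biproduct.ofSplit i q hiq).lTensor (p j).ker).h1Equiv
    exact ⟨H1.congr (homPiTensorSplit k L E F j) ≪≫ₗ β ≪≫ₗ
      LinearEquiv.prodCongr (H1.congr (trivialTensor k L _) ≪≫ₗ α)
        (γ ≪≫ₗ LinearEquiv.prodUnique ≪≫ₗ H1.congr (tensorTrivial k L (p j).ker)) ≪≫ₗ
      LinearEquiv.prodAssoc k _ _ _ ≪≫ₗ
      LinearEquiv.prodCongr (LinearEquiv.refl k _) (LinearEquiv.prodComm k _ _ ≪≫ₗ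
        (piSplitAtLinear j fun i => H1 k L (p i).ker).symm)⟩

/-- `A^m ⊕ (A ⊕ ⨁ P i) ≅ ⨁ (A ⊕ P i)`, with `m + 1` summands. -/
def powerProdEquiv (m : ℕ) (A : Type*) [AddCommGroup A] [Module k A] (P : Fin (m + 1) → Type*)
    [∀ i, AddCommGroup (P i)] [∀ i, Module k (P i)] :
    ((Fin m → A) × A × ∀ i, P i) ≃ₗ[k] ∀ i, A × P i where
  toFun x i := (Fin.cons (α := fun _ => A) x.2.1 x.1 i, x.2.2 i)
  invFun y := (fun i => (y i.succ).1, (y 0).1, fun i => (y i).2)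
  map_add' x y := by
    funext i
    refine Prod.ext ?_ rfl
    cases i using Fin.cases <;> rfl
  map_smul' t x := by
    funext i
    refine Prod.ext ?_ rfl
    cases i using Fin.cases <;> rfl
  left_inv x := rfl
  right_inv y := by
    funext i
    refine Prod.ext ?_ rfl
    cases i using Fin.cases <;> rfl

/-- Extensions between simple tensor products with isomorphic factors, in terms of the extensions
between the factors. -/
theorem nonempty_power_prod_h1_equiv [IsAlgClosed k] [CharZero k] {r : ℕ} (hr : 1 ≤ r)
    {E F : Fin r → Type*} [∀ i, AddCommGroup (E i)] [∀ i, Module k (E i)]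
    [∀ i, LieRingModule L (E i)] [∀ i, LieModule k L (E i)]
    [∀ i, AddCommGroup (F i)] [∀ i, Module k (F i)]
    [∀ i, LieRingModule L (F i)] [∀ i, LieModule k L (F i)]
    [∀ i, FiniteDimensional k (E i)] [∀ i, FiniteDimensional k (F i)]
    [LieModule.IsIrreducible k L (⨂[k] i, E i)] [∀ i, LieModule.IsIrreducible k L (E i)]
    (hsep : Separated k L E F) (φ : ∀ i, Nonempty (E i ≃ₗ⁅k, L⁆ F i)) :
    Nonempty (((Fin (r - 1) → AbDual k L) × H1 k L ((⨂[k] i, E i) →ₗ[k] (⨂[k] i, F i))) ≃ₗ[k]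
      ∀ i, H1 k L (E i →ₗ[k] F i)) := by
  obtain ⟨m, rfl⟩ : ∃ m, r = m + 1 := ⟨r - 1, by omega⟩
  choose s p hsp hp using fun i => exists_trivial_split_hom (φ i).some
  obtain ⟨α⟩ := nonempty_h1_hom_piTensor_equiv_prod (m + 1) (Fintype.card_fin _) hsep φ s p hsp hp
  exact ⟨LinearEquiv.prodCongr (LinearEquiv.refl k (Fin m → AbDual k L)) α ≪≫ₗ
    powerProdEquiv m (AbDual k L) (fun i => H1 k L (p i).ker) ≪≫ₗ
    LinearEquiv.piCongrRight fun i =>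
      LinearEquiv.prodCongr (h1TrivialEquiv k L).symm (LinearEquiv.refl k _) ≪≫ₗ
        (Biproduct.ofSplit (s i) (p i) (hsp i)).h1Equiv.symm⟩

end IsomorphicFactors

/-! ### Functions on the maximal spectrum -/

section Points

variable {k S Γ : Type*} [Field k] [IsAlgClosed k] [CommRing S] [Algebra k S]
  [Algebra.FiniteType k S]

/-- The values of an element of `S` at finitely many maximal ideals can be prescribed. -/
theorem exists_evalPoint_eq (T : Finset (MaximalSpectrum S)) (c : MaximalSpectrum S → k) :
    ∃ s : S, ∀ N ∈ T, evalPoint N s = c N := by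
  have hcop : Pairwise (Function.onFun IsCoprime fun N : T => N.1.asIdeal) := by
    intro N N' h
    rw [Function.onFun, Ideal.isCoprime_iff_sup_eq]
    exact N.1.isMaximal.coprime_of_ne N'.1.isMaximal fun h' =>
      h (Subtype.ext (MaximalSpectrum.ext h'))
  obtain ⟨s, hs⟩ := Ideal.exists_forall_sub_mem_ideal hcop fun N => algebraMap k S (c N)
  exact ⟨s, fun N hN => evalPoint_eq_of_mem N s (c N) (hs ⟨N, hN⟩)⟩

variable [Group Γ] [Finite Γ] [MulSemiringAction Γ S] [SMulCommClass Γ k S]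

/-- Some `Γ`-invariant element of `S` takes the value `1` at `N` and vanishes at all `M ∈ T` outside
the orbit of `N`: the norm of an element with these values on the orbits. -/
theorem exists_invariant_evalPoint (N : MaximalSpectrum S) (T : Finset (MaximalSpectrum S)) :
    ∃ a : S, (∀ γ : Γ, γ • a = a) ∧ evalPoint (k := k) N a = 1 ∧
      ∀ M ∈ T, M ∉ MulAction.orbit Γ N → evalPoint (k := k) M a = 0 := by
  classical
  have := Fintype.ofFinite Γ
  obtain ⟨s, hs⟩ := exists_evalPoint_eq
    ((insert N T).biUnion fun M => Finset.univ.image fun γ : Γ => γ • M)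
    fun M => if M ∈ MulAction.orbit Γ N then (1 : k) else 0
  have hs' : ∀ M ∈ insert N T, ∀ γ : Γ, evalPoint (k := k) (γ • M) s =
      if M ∈ MulAction.orbit Γ N then 1 else 0 := by
    intro M hM γ
    rw [hs _ (Finset.mem_biUnion.mpr
      ⟨M, hM, Finset.mem_image.mpr ⟨γ, Finset.mem_univ _, rfl⟩⟩)]
    congr 1
    rw [← MulAction.orbit_eq_iff, ← MulAction.orbit_eq_iff, MulAction.orbit_smul]
  refine ⟨∏ γ : Γ, γ • s, fun δ => ?_, ?_, fun M hM hMN => ?_⟩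
  · rw [Finset.smul_prod']
    simp only [smul_smul]
    exact Fintype.prod_equiv (Equiv.mulLeft δ) _ _ fun _ => rfl
  · rw [map_prod]
    refine Finset.prod_eq_one fun γ _ => ?_
    rw [evalPoint_smul, hs' N (Finset.mem_insert_self _ _), if_pos (MulAction.mem_orbit_self N)]
  · rw [map_prod]
    refine Finset.prod_eq_zero (Finset.mem_univ (1 : Γ)) ?_
    rw [evalPoint_smul, hs' M (Finset.mem_insert_of_mem hM), if_neg hMN]

end Points

/-! ### The twisted current algebra as an algebra over the invariants -/

section Twisted

variable {k S g Γ : Type*} [Field k] [CommRing S] [Algebra k S]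
  [LieRing g] [LieAlgebra k g] [Group Γ] [MulSemiringAction Γ S] [SMulCommClass Γ k S]
  (u : CrossedHom k S g Γ)

/-- Multiplication by an invariant element of `S` on the twisted current algebra. -/
def CrossedHom.mulInvariant (a : S) (ha : ∀ γ : Γ, γ • a = a) : u.algebra →ₗ[k] u.algebra where
  toFun z := ⟨a • (z : S ⊗[k] g), fun γ => by rw [u.act_smul, ha, z.2 γ]⟩
  map_add' x y := Subtype.ext (smul_add a (x : S ⊗[k] g) y)
  map_smul' t x := Subtype.ext (smul_comm a t (x : S ⊗[k] g))

theorem CrossedHom.isCentroid_mulInvariant (a : S) (ha : ∀ γ : Γ, γ • a = a) :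
    IsCentroid (u.mulInvariant a ha) := fun x y =>
  Subtype.ext (lie_smul a (x : S ⊗[k] g) (y : S ⊗[k] g))

variable [IsAlgClosed k] [Algebra.FiniteType k S]

theorem CrossedHom.evFix_mulInvariant (a : S) (ha : ∀ γ : Γ, γ • a = a) (M : MaximalSpectrum S)
    (z : u.algebra) :
    u.evFix M (u.mulInvariant a ha z) = evalPoint (k := k) M a • u.evFix M z :=
  Subtype.ext (ev_smul M a (z : S ⊗[k] g))

/-- The evaluation `(g ⊗ S)^Γ → g^M` is surjective: for `s` with `s(M) = 1` that vanishes on the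
rest of the orbit of `M`, the value at `M` of the sum of the conjugates of `x ⊗ s` is a multiple
of `x`. -/
theorem CrossedHom.evFix_surjective [CharZero k] [Finite Γ] (M : MaximalSpectrum S) :
    Function.Surjective (u.evFix M) := by
  classical
  have := Fintype.ofFinite Γ
  intro x
  obtain ⟨s, hs⟩ := exists_evalPoint_eq (Finset.univ.image fun γ : Γ => γ • M)
    fun N => if N = M then (1 : k) else 0
  have hs' : ∀ γ : Γ, evalPoint (k := k) (γ • M) s = if γ • M = M then 1 else 0 := fun γ =>
    hs _ (Finset.mem_image.mpr ⟨γ, Finset.mem_univ _, rfl⟩)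
  let z : S ⊗[k] g := ∑ γ : Γ, u.act γ (s ⊗ₜ (x : g))
  have hz : z ∈ u.algebra := by
    intro δ
    rw [map_sum]
    simp only [← u.act_mul]
    exact Fintype.sum_equiv (Equiv.mulLeft δ) _ _ fun _ => rfl
  let n : ℕ := (Finset.univ.filter fun γ : Γ => γ⁻¹ • M = M).card
  have hn : (n : k) ≠ 0 :=
    Nat.cast_ne_zero.mpr (Finset.card_ne_zero_of_mem (a := (1 : Γ)) (by simp))
  have hev : ev M z = (n : k) • (x : g) := by
    have h1 : ∀ γ : Γ, ev M (u.act γ (s ⊗ₜ (x : g))) =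
        if γ⁻¹ • M = M then (x : g) else 0 := by
      intro γ
      rw [u.ev_act, ev_tmul, hs']
      split_ifs with h
      · rw [one_smul]
        exact x.2 γ (inv_smul_eq_iff.mp h).symm
      · rw [zero_smul, map_zero]
    rw [map_sum, Finset.sum_congr rfl fun γ _ => h1 γ, ← Finset.sum_filter, Finset.sum_const,
      ← Nat.cast_smul_eq_nsmul k]
  refine ⟨(n : k)⁻¹ • ⟨z, hz⟩, Subtype.ext ?_⟩
  change ev M ((n : k)⁻¹ • z) = x
  rw [map_smul, hev, inv_smul_smul₀ hn]

theorem CrossedHom.untwist_evFix (γ : Γ) (M N : MaximalSpectrum S) (h : γ • M = N)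
    (z : u.algebra) : u.untwist γ M N h (u.evFix N z) = u.evFix M z := by
  subst h
  refine Subtype.ext ?_
  change (u.autAt γ (γ • M)).symm (ev (γ • M) (z : S ⊗[k] g)) = ev M (z : S ⊗[k] g)
  have h1 := u.ev_act γ⁻¹ M (z : S ⊗[k] g)
  rw [z.2, inv_inv] at h1
  rw [u.autAt_symm_apply, inv_smul_smul, h1]

theorem CrossedHom.actsAsId_mulInvariant {a : S} {ha : ∀ γ : Γ, γ • a = a}
    {M : MaximalSpectrum S} (h : evalPoint (k := k) M a = 1) (V : Type*) [AddCommGroup V]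
    [LieRingModule (u.fix M) V] [Module k V] :
    ActsAsId (u.mulInvariant a ha) (Pullback (u.evFix M) V) := by
  intro z v
  change ⁅u.evFix M (u.mulInvariant a ha z), (show V from v)⁆ = ⁅u.evFix M z, (show V from v)⁆
  rw [u.evFix_mulInvariant, h, one_smul]

theorem CrossedHom.actsAsZero_mulInvariant {a : S} {ha : ∀ γ : Γ, γ • a = a}
    {M : MaximalSpectrum S} (h : evalPoint (k := k) M a = 0) (V : Type*) [AddCommGroup V]
    [LieRingModule (u.fix M) V] [Module k V] :
    ActsAsZero (u.mulInvariant a ha) (Pullback (u.evFix M) V) := by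
  intro z v
  change ⁅u.evFix M (u.mulInvariant a ha z), (show V from v)⁆ = 0
  rw [u.evFix_mulInvariant, h, zero_smul, zero_lie]

end Twisted

/-! ### Uniqueness of the section of an evaluation module -/

section Pullbacks

variable {k L G : Type*} [Field k] [LieRing L] [LieAlgebra k L] [LieRing G] [LieAlgebra k G]
  {V W : Type*} [AddCommGroup V] [Module k V] [LieRingModule G V]
  [AddCommGroup W] [Module k W] [LieRingModule G W]

/-- Pulling back an isomorphism. -/
def Pullback.congr (f : L →ₗ⁅k⁆ G) (e : V ≃ₗ⁅k, G⁆ W) : Pullback f V ≃ₗ⁅k, L⁆ Pullback f W where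
  __ := (show Pullback f V ≃ₗ[k] Pullback f W from e.toLinearEquiv)
  map_lie' := fun {x v} => LieModuleHom.map_lie (e : V →ₗ⁅k, G⁆ W) (f x) v

/-- The pullback along a surjective homomorphism is fully faithful. -/
def Pullback.descend {f : L →ₗ⁅k⁆ G} (hf : Function.Surjective f)
    (e : Pullback f V ≃ₗ⁅k, L⁆ Pullback f W) : V ≃ₗ⁅k, G⁆ W where
  __ := (show V ≃ₗ[k] W from e.toLinearEquiv)
  map_lie' := fun {x v} => by
    obtain ⟨y, rfl⟩ := hf x
    exact LieModuleHom.map_lie (e : Pullback f V →ₗ⁅k, L⁆ Pullback f W) y v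

theorem Pullback.nonempty_equiv_iff {f : L →ₗ⁅k⁆ G} (hf : Function.Surjective f) :
    Nonempty (Pullback f V ≃ₗ⁅k, L⁆ Pullback f W) ↔ Nonempty (V ≃ₗ⁅k, G⁆ W) :=
  ⟨fun ⟨e⟩ => ⟨Pullback.descend hf e⟩, fun ⟨e⟩ => ⟨Pullback.congr f e⟩⟩

theorem Rep.mk_pullback_congr [LieModule k G V] [FiniteDimensional k V] {f f' : L →ₗ⁅k⁆ G}
    (h : f = f') [LieModule.IsIrreducible k L (Pullback f V)]
    [LieModule.IsIrreducible k L (Pullback f' V)] :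
    Rep.mk k L (Pullback f V) = Rep.mk k L (Pullback f' V) := by
  subst h
  rfl

/-- The pullback of the trivial module is trivial. -/
def trivialPullback (f : L →ₗ⁅k⁆ G) :
    TrivialLieModule k L k ≃ₗ⁅k, L⁆ Pullback f (TrivialLieModule k G k) where
  __ := (LinearEquiv.refl k k : TrivialLieModule k L k ≃ₗ[k] Pullback f (TrivialLieModule k G k))
  map_lie' := rfl

/-- Tensoring an isomorphism with a module. -/
def tensorCongrLeft {E E' : Type*} [AddCommGroup E] [Module k E] [LieRingModule L E]
    [LieModule k L E] [AddCommGroup E'] [Module k E'] [LieRingModule L E'] [LieModule k L E']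
    (e : E ≃ₗ⁅k, L⁆ E') (F : Type*) [AddCommGroup F] [Module k F] [LieRingModule L F]
    [LieModule k L F] : E ⊗[k] F ≃ₗ⁅k, L⁆ E' ⊗[k] F where
  __ := LinearEquiv.rTensor F e.toLinearEquiv
  map_lie' := fun {x z} => LieModuleHom.map_lie
    (TensorProduct.LieModule.map (e : E →ₗ⁅k, L⁆ E') (LieModuleHom.id : F →ₗ⁅k, L⁆ F)) x z

end Pullbacks

section Sections

universe u

variable {k : Type u} {S g Γ : Type*} [Field k] [IsAlgClosed k] [CommRing S] [Algebra k S]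
  [Algebra.FiniteType k S] [LieRing g] [LieAlgebra k g] [Group Γ] [MulSemiringAction Γ S]
  [SMulCommClass Γ k S] (u : CrossedHom k S g Γ)

section

variable {r : ℕ} (M : Fin r → MaximalSpectrum S)
  (hM : ∀ i j, M i ∈ MulAction.orbit Γ (M j) → i = j) (E F : Fin r → Type u)
  [∀ i, AddCommGroup (E i)] [∀ i, Module k (E i)] [∀ i, LieRingModule (u.fix (M i)) (E i)]
  [∀ i, LieModule k (u.fix (M i)) (E i)] [∀ i, FiniteDimensional k (E i)]
  [∀ i, LieModule.IsIrreducible k (u.fix (M i)) (E i)]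
  [∀ i, AddCommGroup (F i)] [∀ i, Module k (F i)] [∀ i, LieRingModule (u.fix (M i)) (F i)]
  [∀ i, LieModule k (u.fix (M i)) (F i)] [∀ i, FiniteDimensional k (F i)]
  [∀ i, LieModule.IsIrreducible k (u.fix (M i)) (F i)]

include hM in
/-- The value of a section at `γ M_j`, for an arbitrary `γ`. -/
theorem sectionOf_eq_mk (N : MaximalSpectrum S) (j : Fin r) (γ : Γ) (hγ : γ • M j = N)
    [LieModule.IsIrreducible k (u.fix N) (Pullback (u.untwist γ (M j) N hγ) (E j))] :
    sectionOf u M E N = Rep.mk k (u.fix N) (Pullback (u.untwist γ (M j) N hγ) (E j)) := by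
  have key : ∀ (p : Fin r × Γ) (hp : p.2 • M p.1 = N)
      [LieModule.IsIrreducible k (u.fix N) (Pullback (u.untwist p.2 (M p.1) N hp) (E p.1))],
      Rep.mk k (u.fix N) (Pullback (u.untwist p.2 (M p.1) N hp) (E p.1)) =
        Rep.mk k (u.fix N) (Pullback (u.untwist γ (M j) N hγ) (E j)) := by
    rintro ⟨i, δ⟩ hp _
    have hij : i = j := by
      apply hM
      rw [← MulAction.orbit_eq_iff, ← MulAction.orbit_smul δ (M i), ← MulAction.orbit_smul γ (M j)]
      exact congrArg _ (hp.trans hγ.symm)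
    subst hij
    exact Rep.mk_pullback_congr (u.untwist_eq _ _ _ _ _ _)
  have h : ∃ p : Fin r × Γ, p.2 • M p.1 = N := ⟨(j, γ), hγ⟩
  have := Pullback.isIrreducible (u.untwist h.choose.2 (M h.choose.1) N h.choose_spec)
    (E h.choose.1) (u.untwist_surjective _ _ _ _)
  exact (dif_pos h).trans (key h.choose h.choose_spec)

include hM in
/-- On the orbit of `M j`, two sections attached to the same points agree if and only if their
modules at `M j` are isomorphic. -/
theorem sectionOf_eq_iff (N : MaximalSpectrum S) (j : Fin r) (hN : N ∈ MulAction.orbit Γ (M j)) :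
    sectionOf u M E N = sectionOf u M F N ↔ Nonempty (E j ≃ₗ⁅k, u.fix (M j)⁆ F j) := by
  obtain ⟨γ, hγ⟩ := hN
  have hγ : γ • M j = N := hγ
  have := Pullback.isIrreducible (u.untwist γ (M j) N hγ) (E j) (u.untwist_surjective _ _ _ _)
  have := Pullback.isIrreducible (u.untwist γ (M j) N hγ) (F j) (u.untwist_surjective _ _ _ _)
  rw [sectionOf_eq_mk u M hM E N j γ hγ, sectionOf_eq_mk u M hM F N j γ hγ,
    ← Pullback.nonempty_equiv_iff (u.untwist_surjective γ (M j) N hγ)]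
  exact Quotient.eq

/-- At a point off the orbits of the `M i`, a section is trivial. -/
theorem sectionOf_of_notMem (N : MaximalSpectrum S) (h : ∀ i, N ∉ MulAction.orbit Γ (M i)) :
    sectionOf u M E N = Rep.trivial k (u.fix N) :=
  dif_neg fun ⟨p, hp⟩ => h p.1 ⟨p.2, hp⟩

include hM in
/-- For each point `N`, an evaluation module is the tensor product of the value of its section at
`N` and a module that is annihilated by the elements of the algebra supported on the orbit of
`N`. -/
theorem exists_sectionOf_factor (N : MaximalSpectrum S) :
    ∃ (Q : SimpleModule.{u} k (u.fix N)) (R : Type u) (_ : AddCommGroup R) (_ : Module k R)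
      (_ : LieRingModule u.algebra R) (_ : LieModule k u.algebra R) (_ : FiniteDimensional k R),
      sectionOf u M E N = Rep.mk k (u.fix N) Q.V ∧
      Nonempty (EvalTensor u M E ≃ₗ⁅k, u.algebra⁆ Pullback (u.evFix N) Q.V ⊗[k] R) ∧
      ∀ (a : S) (ha : ∀ γ : Γ, γ • a = a),
        (∀ i, M i ∉ MulAction.orbit Γ N → evalPoint (k := k) (M i) a = 0) →
          ActsAsZero (u.mulInvariant a ha) R := by
  by_cases h : ∃ j, N ∈ MulAction.orbit Γ (M j)
  · obtain ⟨j, γ, hγ⟩ := h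
    have hγ : γ • M j = N := hγ
    have := Pullback.isIrreducible (u.untwist γ (M j) N hγ) (E j) (u.untwist_surjective _ _ _ _)
    let ψ : Pullback (u.evFix (M j)) (E j) ≃ₗ⁅k, u.algebra⁆
        Pullback (u.evFix N) (Pullback (u.untwist γ (M j) N hγ) (E j)) :=
      { (LinearEquiv.refl k (E j) : Pullback (u.evFix (M j)) (E j) ≃ₗ[k]
          Pullback (u.evFix N) (Pullback (u.untwist γ (M j) N hγ) (E j))) with
        map_lie' := fun {x v} => by
          change ⁅u.evFix (M j) x, (show E j from v)⁆ =
            ⁅u.untwist γ (M j) N hγ (u.evFix N x), (show E j from v)⁆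
          rw [u.untwist_evFix] }
    refine ⟨⟨Pullback (u.untwist γ (M j) N hγ) (E j)⟩,
      ⨂[k] i : {i // i ≠ j}, Pullback (u.evFix (M i)) (E i), inferInstance,
      inferInstance, inferInstance, inferInstance, inferInstance,
      sectionOf_eq_mk u M hM E N j γ hγ,
      ⟨(piTensorSplit _ j).trans (tensorCongrLeft ψ _)⟩, fun a ha h0 => ?_⟩
    refine ActsAsZero.piTensor fun i => u.actsAsZero_mulInvariant (h0 i fun hi => i.2 ?_) _
    apply hM
    rw [← MulAction.orbit_eq_iff] at hi ⊢
    rw [hi, ← hγ, MulAction.orbit_smul]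
  · refine ⟨⟨TrivialLieModule k (u.fix N) k⟩, EvalTensor u M E, inferInstance,
      inferInstance, inferInstance, inferInstance, inferInstance,
      sectionOf_of_notMem u M E N fun j hj => h ⟨j, hj⟩,
      ⟨(trivialTensor k u.algebra _).symm.trans (tensorCongrLeft (trivialPullback _) _)⟩,
      fun a ha h0 => ?_⟩
    refine ActsAsZero.piTensor fun i => u.actsAsZero_mulInvariant (h0 i fun hi => h ⟨i, ?_⟩) _
    rwa [MulAction.mem_orbit_symm]

include hM in
/-- The section of an evaluation module is determined by the module. -/
theorem sectionOf_unique [Finite Γ] [CharZero k] {r' : ℕ} (M' : Fin r' → MaximalSpectrum S)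
    (hM' : ∀ i j, M' i ∈ MulAction.orbit Γ (M' j) → i = j) (E' : Fin r' → Type u)
    [∀ i, AddCommGroup (E' i)] [∀ i, Module k (E' i)] [∀ i, LieRingModule (u.fix (M' i)) (E' i)]
    [∀ i, LieModule k (u.fix (M' i)) (E' i)] [∀ i, FiniteDimensional k (E' i)]
    [∀ i, LieModule.IsIrreducible k (u.fix (M' i)) (E' i)]
    (X : Type u) [AddCommGroup X] [Module k X] [LieRingModule u.algebra X]
    [LieModule k u.algebra X] [Nontrivial X]
    (α : X ≃ₗ⁅k, u.algebra⁆ EvalTensor u M E) (β : X ≃ₗ⁅k, u.algebra⁆ EvalTensor u M' E') :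
    sectionOf u M E = sectionOf u M' E' := by
  classical
  funext N
  obtain ⟨Q, R, _, _, _, _, _, hQ, ⟨φ⟩, hR⟩ := exists_sectionOf_factor u M hM E N
  obtain ⟨Q', R', _, _, _, _, _, hQ', ⟨φ'⟩, hR'⟩ := exists_sectionOf_factor u M' hM' E' N
  obtain ⟨a, ha, haN, ha0⟩ := exists_invariant_evalPoint (k := k) (Γ := Γ) N
    (Finset.univ.image M ∪ Finset.univ.image M')
  have := Pullback.isIrreducible (u.evFix N) Q.V (u.evFix_surjective N)
  have := Pullback.isIrreducible (u.evFix N) Q'.V (u.evFix_surjective N)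
  obtain ⟨e⟩ := nonempty_equiv_of_tensor (u.mulInvariant a ha)
    (u.actsAsId_mulInvariant haN Q.V)
    (hR a ha fun i hi => ha0 _ (Finset.mem_union_left _ (Finset.mem_image_of_mem M
      (Finset.mem_univ i))) hi)
    (u.actsAsId_mulInvariant haN Q'.V)
    (hR' a ha fun i hi => ha0 _ (Finset.mem_union_right _ (Finset.mem_image_of_mem M'
      (Finset.mem_univ i))) hi)
    (α.trans φ) (β.trans φ')
  rw [hQ, hQ']
  exact Quotient.sound ⟨Pullback.descend (u.evFix_surjective N) e⟩

end

end Sections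

/-! ### Separation of orbits -/

section Separation

universe u

variable {k : Type u} {S g Γ : Type*} [Field k] [IsAlgClosed k] [CommRing S] [Algebra k S]
  [Algebra.FiniteType k S] [LieRing g] [LieAlgebra k g] [Group Γ] [MulSemiringAction Γ S]
  [SMulCommClass Γ k S] (u : CrossedHom k S g Γ)

/-- Evaluation modules at points in distinct orbits are separated by the invariants of `S`. -/
theorem separated_pullback [Finite Γ] {r : ℕ} (M : Fin r → MaximalSpectrum S)
    (hM : ∀ i j, M i ∈ MulAction.orbit Γ (M j) → i = j) (E F : Fin r → Type u)
    [∀ i, AddCommGroup (E i)] [∀ i, Module k (E i)] [∀ i, LieRingModule (u.fix (M i)) (E i)]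
    [∀ i, AddCommGroup (F i)] [∀ i, Module k (F i)] [∀ i, LieRingModule (u.fix (M i)) (F i)] :
    Separated k u.algebra (fun i => Pullback (u.evFix (M i)) (E i))
      (fun i => Pullback (u.evFix (M i)) (F i)) := by
  classical
  intro j
  obtain ⟨a, ha, haj, ha0⟩ := exists_invariant_evalPoint (k := k) (Γ := Γ) (M j)
    (Finset.univ.image M)
  have h0 : ∀ i, i ≠ j → evalPoint (k := k) (M i) a = 0 := fun i hi =>
    ha0 _ (Finset.mem_image_of_mem M (Finset.mem_univ i)) fun h => hi (hM i j h)
  exact ⟨u.mulInvariant a ha, u.isCentroid_mulInvariant a ha, u.actsAsId_mulInvariant haj (E j),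
    u.actsAsId_mulInvariant haj (F j), fun i hi =>
      ⟨u.actsAsZero_mulInvariant (h0 i hi) (E i), u.actsAsZero_mulInvariant (h0 i hi) (F i)⟩⟩

end Separation

end

end TwistedCurrent

theorem mainTheorem5
    {k : Type w} {S g Γ : Type*}
    [Field k] [IsAlgClosed k] [CharZero k]
    [CommRing S] [Algebra k S] [Algebra.FiniteType k S]
    [LieRing g] [LieAlgebra k g] (hg : IsReductive k g)
    [Group Γ] [Finite Γ] [MulSemiringAction Γ S] [SMulCommClass Γ k S]
    (u : CrossedHom k S g Γ)
    -- `E` and `F` are simple finite-dimensional evaluation modules over `L = (g ⊗ S)^Γ`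
    (E F : Type w)
    [AddCommGroup E] [Module k E] [LieRingModule u.algebra E] [LieModule k u.algebra E]
    [AddCommGroup F] [Module k F] [LieRingModule u.algebra F] [LieModule k u.algebra F]
    [FiniteDimensional k E] [FiniteDimensional k F]
    [LieModule.IsIrreducible k u.algebra E] [LieModule.IsIrreducible k u.algebra F]
    (hE : IsEvaluationModule u E) (hF : IsEvaluationModule u F)
    -- with corresponding sections `fE` and `fF`
    (fE fF : RepSection u) (hfE : IsSectionOf u E fE) (hfF : IsSectionOf u F fF)
    -- `M₁, …, M_r` are representatives of the orbits in `supp E ∪ supp F`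
    (r : ℕ) (M : Fin r → MaximalSpectrum S)
    (hM : IsOrbitRepresentatives Γ M (fE.supp ∪ fF.supp))
    -- `E = E₁ ⊗ ⋯ ⊗ E_r` and `F = F₁ ⊗ ⋯ ⊗ F_r` with `E_i`, `F_i` simple over `g^{M_i}`
    (E' F' : Fin r → Type w)
    [∀ i, AddCommGroup (E' i)] [∀ i, Module k (E' i)]
    [∀ i, LieRingModule (u.fix (M i)) (E' i)] [∀ i, LieModule k (u.fix (M i)) (E' i)]
    [∀ i, AddCommGroup (F' i)] [∀ i, Module k (F' i)]
    [∀ i, LieRingModule (u.fix (M i)) (F' i)] [∀ i, LieModule k (u.fix (M i)) (F' i)]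
    [∀ i, FiniteDimensional k (E' i)] [∀ i, FiniteDimensional k (F' i)]
    [∀ i, LieModule.IsIrreducible k (u.fix (M i)) (E' i)]
    [∀ i, LieModule.IsIrreducible k (u.fix (M i)) (F' i)]
    (hEE' : Nonempty (E ≃ₗ⁅k, u.algebra⁆ EvalTensor u M E'))
    (hFF' : Nonempty (F ≃ₗ⁅k, u.algebra⁆ EvalTensor u M F')) :
    -- (1) the sections differ on more than one orbit
    ((∃ N N' : MaximalSpectrum S, N' ∉ MulAction.orbit Γ N ∧ fE N ≠ fF N ∧ fE N' ≠ fF N') →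
      Subsingleton (Ext1 k u.algebra E F)) ∧
    -- (2) the sections differ exactly on the orbit of `M_j`
    (∀ j, {N | fE N ≠ fF N} = MulAction.orbit Γ (M j) →
      Nonempty (Ext1 k u.algebra E F ≃ₗ[k]
        Ext1 k u.algebra (Pullback (u.evFix (M j)) (E' j)) (Pullback (u.evFix (M j)) (F' j)))) ∧
    -- (3) the sections are equal (and the common support is not empty)
    (fE = fF → 1 ≤ r →
      Nonempty (((Fin (r - 1) → AbDual k u.algebra) × Ext1 k u.algebra E F) ≃ₗ[k]
        (∀ i, Ext1 k u.algebra (Pullback (u.evFix (M i)) (E' i))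
          (Pullback (u.evFix (M i)) (F' i))))) := by
  have hE0 : Nontrivial E := (LieSubmodule.nontrivial_iff k u.algebra E).mp inferInstance
  have hF0 : Nontrivial F := (LieSubmodule.nontrivial_iff k u.algebra F).mp inferInstance
  obtain ⟨α⟩ := hEE'
  obtain ⟨β⟩ := hFF'
  have hdist : ∀ i j, M i ∈ MulAction.orbit Γ (M j) → i = j := fun i j h =>
    (hM.2 (M i) (hM.1 i)).unique (MulAction.mem_orbit_self _) h
  -- both sections can be computed from the given decompositions
  obtain ⟨rE, ME, VE, hME, ⟨α'⟩, hfE⟩ := hfE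
  obtain ⟨rF, MF, VF, hMF, ⟨β'⟩, hfF⟩ := hfF
  replace hfE : fE = sectionOf u M E' := hfE.trans
    (sectionOf_unique u ME hME (fun i => (VE i).V) M hdist E' E α' α)
  replace hfF : fF = sectionOf u M F' := hfF.trans
    (sectionOf_unique u MF hMF (fun i => (VF i).V) M hdist F' F β' β)
  have hiff : ∀ N j, N ∈ MulAction.orbit Γ (M j) → (fE N = fF N ↔
      Nonempty (Pullback (u.evFix (M j)) (E' j) ≃ₗ⁅k, u.algebra⁆
        Pullback (u.evFix (M j)) (F' j))) := fun N j hN => by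
    rw [hfE, hfF, sectionOf_eq_iff u M hdist E' F' N j hN,
      Pullback.nonempty_equiv_iff (u.evFix_surjective (M j))]
  have hirrE : ∀ i, LieModule.IsIrreducible k u.algebra (Pullback (u.evFix (M i)) (E' i)) :=
    fun i => Pullback.isIrreducible _ _ (u.evFix_surjective (M i))
  have hirrF : ∀ i, LieModule.IsIrreducible k u.algebra (Pullback (u.evFix (M i)) (F' i)) :=
    fun i => Pullback.isIrreducible _ _ (u.evFix_surjective (M i))
  have hirr : LieModule.IsIrreducible k u.algebra (EvalTensor u M E') := isIrreducible_of_equiv α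
  have hsep := separated_pullback u M hdist E' F'
  let ε : Ext1 k u.algebra E F ≃ₗ[k]
      H1 k u.algebra (EvalTensor u M E' →ₗ[k] EvalTensor u M F') :=
    ext1Equiv k u.algebra E F ≪≫ₗ H1.congr (homCongr α β)
  refine ⟨?_, fun j hj => ?_, fun hEF hr => ?_⟩
  · rintro ⟨N, N', hNN', hN, hN'⟩
    have hmem : ∀ N, fE N ≠ fF N → ∃ j, N ∈ MulAction.orbit Γ (M j) := by
      intro N hN
      by_contra! h
      rw [hfE, hfF, sectionOf_of_notMem u M E' N h, sectionOf_of_notMem u M F' N h] at hN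
      exact hN rfl
    obtain ⟨j, hj⟩ := hmem N hN
    obtain ⟨j', hj'⟩ := hmem N' hN'
    have hjj' : j' ≠ j := by
      rintro rfl
      rw [← MulAction.orbit_eq_iff] at hj hj'
      exact hNN' (MulAction.orbit_eq_iff.mp (hj'.trans hj.symm))
    exact ε.toEquiv.subsingleton_congr.mpr (h1_hom_piTensor_subsingleton hsep j j' hjj'
      (mt (hiff N j hj).mpr hN) (mt (hiff N' j' hj').mpr hN'))
  · have hmem : ∀ N, fE N ≠ fF N ↔ N ∈ MulAction.orbit Γ (M j) := fun N => Set.ext_iff.mp hj N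
    have hself : ∀ i, M i ∈ MulAction.orbit Γ (M i) := fun i => MulAction.mem_orbit_self _
    obtain ⟨θ⟩ := nonempty_h1_hom_piTensor_equiv hsep j
      (mt (hiff (M j) j (hself j)).mpr ((hmem _).mpr (hself j)))
      fun i hi => (hiff (M i) i (hself i)).mp
        (not_not.mp (mt (hmem (M i)).mp fun h => hi (hdist i j h)))
    exact ⟨ε ≪≫ₗ θ ≪≫ₗ (ext1Equiv k u.algebra _ _).symm⟩
  · obtain ⟨θ⟩ := nonempty_power_prod_h1_equiv hr hsep fun i =>
      (hiff (M i) i (MulAction.mem_orbit_self _)).mp (congrFun hEF _)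
    exact ⟨LinearEquiv.prodCongr (LinearEquiv.refl k _) ε ≪≫ₗ θ ≪≫ₗ
      LinearEquiv.piCongrRight fun i => (ext1Equiv k u.algebra _ _).symm⟩
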